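/- Let $k$ be a field, let $n,d\ge 0$ be integers, and let $S=k[x_1,\dots,x_n]$ with the standard grading. A monomial complete intersection is an ideal $I\subset S$ that is generated by monomials and is a complete intersection, i.e. $I$ is a proper ideal generated by a (possibly empty) $S$-regular sequence. For a homogeneous ideal $I\subseteq S$ with minimal graded free resolution $$0\to\bigoplus_j S(-b_{mj})\to\cdots\to\bigoplus_j S(-b_{0j})\to I\to 0$$ (all free modules finitely generated, all differentials given by matrices with entries in $(x_1,\dots,x_n)$), the Castelnuovo–Mumford regularity is $\operatorname{reg}(I)=\max\{b_{ij}-i\}$, the maximum being over all $i,j$, with $\operatorname{reg}(0)=-\infty$. Theorem. Let $I_1,\dots,I_d\subset S$ be monomial complete intersections. Then the ideals $I_1,\dots,I_d$ and $I_1\cap\cdots\cap I_d$ have finite minimal graded free resolutions, and $$\operatorname{reg}(I_1\cap\cdots\cap I_d)\le \operatorname{reg}(I_1)+\cdots+\operatorname{reg}(I_d).$$ (For $d=0$ the intersection is $S$ and the sum is $0$.) -/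

import Mathlib

/-- `p` is homogeneous of degree `a`, where `a` is an integer (so `p = 0` if `a < 0`). -/
def IsHomogeneousOfIntDegree {k : Type*} [Field k] {n : ℕ}
    (p : MvPolynomial (Fin n) k) (a : ℤ) : Prop :=
  ∀ m ∈ p.support, (m.degree : ℤ) = a

/-- A finite graded free resolution
`0 → F_length → ⋯ → F_1 → F_0 → I → 0`
of an ideal `I` of the standard graded ring `S = k[x_0, …, x_{n-1}]` by finitely generated graded
free modules. The module `F_i = ⨁_j S(-b_{ij})` is `Fin (rank i) → S`, its `j`-th basis vector
being placed in degree `b_{ij} = shift i j`. The last map is `aug : F_0 → S`, with image `I`. -/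
structure GradedFreeResolution {k : Type*} [Field k] {n : ℕ}
    (I : Ideal (MvPolynomial (Fin n) k)) where
  /-- A bound for the length of the resolution. -/
  length : ℕ
  /-- The rank of `F_i`. -/
  rank : ℕ → ℕ
  rank_eq_zero : ∀ i, length < i → rank i = 0
  /-- The degrees `b_{ij}` of the basis vectors of `F_i`. -/
  shift : (i : ℕ) → Fin (rank i) → ℤ
  /-- The augmentation `F_0 → I ⊆ S`. -/
  aug : (Fin (rank 0) → MvPolynomial (Fin n) k) →ₗ[MvPolynomial (Fin n) k] MvPolynomial (Fin n) k
  /-- The differential `F_{i+1} → F_i`. -/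
  d : (i : ℕ) → (Fin (rank (i + 1)) → MvPolynomial (Fin n) k) →ₗ[MvPolynomial (Fin n) k]
    (Fin (rank i) → MvPolynomial (Fin n) k)
  range_aug : LinearMap.range aug = I
  exact_zero : LinearMap.range (d 0) = LinearMap.ker aug
  exact_succ : ∀ i, LinearMap.range (d (i + 1)) = LinearMap.ker (d i)
  /-- The augmentation preserves degrees. -/
  aug_homogeneous : ∀ j, IsHomogeneousOfIntDegree (aug (Pi.single j 1)) (shift 0 j)
  /-- The differentials preserve degrees. -/
  d_homogeneous : ∀ i j l,
    IsHomogeneousOfIntDegree (d i (Pi.single j 1) l) (shift (i + 1) j - shift i l)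

/-- A graded free resolution is minimal if `F_{i+1}` is mapped into `(x_0, …, x_{n-1}) F_i` for all
`i ≥ 0`, i.e. all entries of the matrices of the differentials have constant term zero. -/
def GradedFreeResolution.IsMinimal {k : Type*} [Field k] {n : ℕ}
    {I : Ideal (MvPolynomial (Fin n) k)} (R : GradedFreeResolution I) : Prop :=
  ∀ i j l, MvPolynomial.constantCoeff (R.d i (Pi.single j 1) l) = 0

/-- `max {b_{ij} - i}`, the maximum over the empty set being `-∞`. -/
def GradedFreeResolution.maxShift {k : Type*} [Field k] {n : ℕ}
    {I : Ideal (MvPolynomial (Fin n) k)} (R : GradedFreeResolution I) : WithBot ℤ :=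
  (Finset.range (R.length + 1)).sup fun i =>
    Finset.univ.sup fun j : Fin (R.rank i) => ((R.shift i j - (i : ℤ) : ℤ) : WithBot ℤ)

/-- `I` has a (finite) minimal graded free resolution. -/
def HasMinimalResolution {k : Type*} [Field k] {n : ℕ}
    (I : Ideal (MvPolynomial (Fin n) k)) : Prop :=
  ∃ R : GradedFreeResolution I, R.IsMinimal

open Classical in
/-- The Castelnuovo–Mumford regularity of a homogeneous ideal `I`: the number `max {b_{ij} - i}`
of a minimal graded free resolution of `I`. Minimal resolutions are unique up to isomorphism, so
that the number does not depend on the choice. The zero ideal has regularity `-∞`. -/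
noncomputable def castelnuovoMumfordReg {k : Type*} [Field k] {n : ℕ}
    (I : Ideal (MvPolynomial (Fin n) k)) : WithBot ℤ :=
  if h : HasMinimalResolution I then h.choose.maxShift else ⊥

/-- A monomial ideal: an ideal generated by monomials. -/
def IsMonomialIdeal {k : Type*} [Field k] {n : ℕ}
    (I : Ideal (MvPolynomial (Fin n) k)) : Prop :=
  ∃ A : Set (Fin n →₀ ℕ), I = Ideal.span ((fun a => MvPolynomial.monomial a (1 : k)) '' A)

/-- A complete intersection: a (proper) ideal generated by a regular sequence. -/
def IsCompleteIntersection {k : Type*} [Field k] {n : ℕ}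
    (I : Ideal (MvPolynomial (Fin n) k)) : Prop :=
  ∃ rs : List (MvPolynomial (Fin n) k),
    RingTheory.Sequence.IsRegular (MvPolynomial (Fin n) k) rs ∧ Ideal.ofList rs = I

/-- A monomial complete intersection: a monomial ideal which is a complete intersection. -/
def IsMonomialCompleteIntersection {k : Type*} [Field k] {n : ℕ}
    (I : Ideal (MvPolynomial (Fin n) k)) : Prop :=
  IsMonomialIdeal I ∧ IsCompleteIntersection I

/-! A multigraded free resolution of a monomial ideal is determined by scalars: a multidegree for
each basis vector, the matrix `D` of coefficients of the differential, and the row `ε` of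
coefficients of the augmentation. Its strand in multidegree b is the complex of k-vector spaces on
the basis vectors with `deg j ≤ b`; its only homology is k if x^b lies in the ideal, and zero
otherwise.

Given resolutions of I and J, tensor the scalar complexes but give a pair of basis vectors the join
(lcm) of the two multidegrees instead of their sum. A join is ≤ b exactly when both degrees are, so
the strand at b is the tensor product of the two strands. By Künneth over k its homology is k
exactly when x^b lies in I ∩ J: this resolves I ∩ J (`inter`, `ideal_inter`). Homological degrees
add and the degree of an lcm is at most the sum of the degrees, so max(b_ij - i) is subadditive
(`maxShift_inter_le`).

Two further facts turn this into a statement on regularity. Iterated mapping cones followed by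
cancellation give every monomial ideal a minimal resolution of this kind (`exists_isMinimal`). The
shifts of a minimal resolution occur in every graded resolution (`IsMinimal.exists_shift_eq`), so
regularity is well defined and bounded by the shifts of any resolution, such as the usually
non-minimal one of the intersection. -/

open MvPolynomial

/-! ### Homogeneous components in integer degrees -/

section Component

variable {k : Type*} [Field k] {n : ℕ}

/-- The homogeneous component of degree `a ∈ ℤ` of a polynomial. -/
noncomputable def intHomogeneousComponent (a : ℤ) :
    MvPolynomial (Fin n) k →ₗ[k] MvPolynomial (Fin n) k :=
  if a < 0 then 0 else homogeneousComponent a.toNat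

theorem coeff_intHomogeneousComponent (a : ℤ) (p : MvPolynomial (Fin n) k) (m : Fin n →₀ ℕ) :
    coeff m (intHomogeneousComponent a p) = if (m.degree : ℤ) = a then coeff m p else 0 := by
  unfold intHomogeneousComponent
  split_ifs with h1 h2 h2
  · omega
  · simp
  · rw [coeff_homogeneousComponent, if_pos (by omega)]
  · rw [coeff_homogeneousComponent, if_neg (by omega)]

theorem isHomogeneousOfIntDegree_intHomogeneousComponent (a : ℤ) (p : MvPolynomial (Fin n) k) :
    IsHomogeneousOfIntDegree (intHomogeneousComponent a p) a := by
  intro m hm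
  rw [mem_support_iff, coeff_intHomogeneousComponent] at hm
  by_contra h
  exact hm (if_neg h)

theorem IsHomogeneousOfIntDegree.intHomogeneousComponent_eq {p : MvPolynomial (Fin n) k} {e : ℤ}
    (hp : IsHomogeneousOfIntDegree p e) (a : ℤ) :
    intHomogeneousComponent a p = if a = e then p else 0 := by
  ext m
  rw [coeff_intHomogeneousComponent]
  by_cases hm : coeff m p = 0
  · split_ifs <;> simp [hm]
  · rw [hp m (mem_support_iff.2 hm)]
    by_cases h : a = e
    · simp [h]
    · rw [if_neg (Ne.symm h), if_neg h, coeff_zero]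

theorem IsHomogeneousOfIntDegree.mul {p q : MvPolynomial (Fin n) k} {a b : ℤ}
    (hp : IsHomogeneousOfIntDegree p a) (hq : IsHomogeneousOfIntDegree q b) :
    IsHomogeneousOfIntDegree (p * q) (a + b) := by
  classical
  intro m hm
  obtain ⟨u, hu, v, hv, rfl⟩ := Finset.mem_add.1 (support_mul p q hm)
  rw [map_add, Nat.cast_add, hp u hu, hq v hv]

theorem isHomogeneousOfIntDegree_monomial (m : Fin n →₀ ℕ) (c : k) :
    IsHomogeneousOfIntDegree (monomial m c) (m.degree : ℤ) := by
  classical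
  intro u hu
  rw [mem_support_iff, coeff_monomial] at hu
  by_cases h : m = u
  · rw [h]
  · exact absurd (if_neg h) hu

theorem IsHomogeneousOfIntDegree.sum {ι : Type*} {s : Finset ι} {f : ι → MvPolynomial (Fin n) k}
    {a : ℤ} (hf : ∀ i ∈ s, IsHomogeneousOfIntDegree (f i) a) :
    IsHomogeneousOfIntDegree (∑ i ∈ s, f i) a := by
  intro m hm
  rw [mem_support_iff, coeff_sum] at hm
  obtain ⟨i, hi, h⟩ := Finset.exists_ne_zero_of_sum_ne_zero hm
  exact hf i hi m (mem_support_iff.2 h)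

theorem intHomogeneousComponent_mul {q : MvPolynomial (Fin n) k} {e : ℤ}
    (hq : IsHomogeneousOfIntDegree q e) (p : MvPolynomial (Fin n) k) (a : ℤ) :
    intHomogeneousComponent (a + e) (p * q) = intHomogeneousComponent a p * q := by
  induction p using MvPolynomial.induction_on' with
  | monomial m c =>
    have h := isHomogeneousOfIntDegree_monomial m c
    rw [(h.mul hq).intHomogeneousComponent_eq, h.intHomogeneousComponent_eq]
    simp only [add_left_inj]
    split_ifs <;> simp
  | add p p' h h' => rw [add_mul, map_add, map_add, h, h', add_mul]

/-- Applied to entries of comparison maps: an entry with nonzero constant term joins two basis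
vectors of equal shift. -/
theorem IsHomogeneousOfIntDegree.eq_zero_of_constantCoeff_ne_zero {p : MvPolynomial (Fin n) k}
    {a : ℤ} (hp : IsHomogeneousOfIntDegree p a) (h : constantCoeff p ≠ 0) : a = 0 := by
  have := hp 0 (mem_support_iff.2 h)
  simpa using this.symm

end Component

/-! ### Degree preserving lifts between graded free modules -/

section Lifting

variable {k : Type*} [Field k] {n : ℕ}

theorem linearMap_pi_apply_eq_sum {R ι κ : Type*} [CommRing R] [Fintype ι] [DecidableEq ι]
    (f : (ι → R) →ₗ[R] (κ → R)) (v : ι → R) (l : κ) :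
    f v l = ∑ j, v j * f (Pi.single j 1) l := by
  conv_lhs => rw [pi_eq_sum_univ' v]
  simp [map_sum, Finset.sum_apply]

/-- A homogeneous element in the image of a degree preserving map of graded free modules is the
image of a homogeneous element. -/
theorem exists_homogeneous_preimage {s : ℕ} {κ : Type*}
    (f : (Fin s → MvPolynomial (Fin n) k) →ₗ[MvPolynomial (Fin n) k] (κ → MvPolynomial (Fin n) k))
    (b : Fin s → ℤ) (b' : κ → ℤ)
    (hf : ∀ j l, IsHomogeneousOfIntDegree (f (Pi.single j 1) l) (b j - b' l))
    (w : κ → MvPolynomial (Fin n) k) (hw : w ∈ LinearMap.range f) (c : ℤ)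
    (hwc : ∀ l, IsHomogeneousOfIntDegree (w l) (c - b' l)) :
    ∃ v, f v = w ∧ ∀ j, IsHomogeneousOfIntDegree (v j) (c - b j) := by
  obtain ⟨v, rfl⟩ := hw
  -- Any preimage may be replaced by its component of degree `c`, since `f` preserves degrees and
  -- `w` is already homogeneous.
  refine ⟨fun j => intHomogeneousComponent (c - b j) (v j), ?_,
    fun j => isHomogeneousOfIntDegree_intHomogeneousComponent _ _⟩
  ext1 l
  have h := (hwc l).intHomogeneousComponent_eq (c - b' l)
  rw [if_pos rfl, linearMap_pi_apply_eq_sum, map_sum] at h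
  rw [linearMap_pi_apply_eq_sum, linearMap_pi_apply_eq_sum f v, ← h]
  refine Finset.sum_congr rfl fun j _ => ?_
  rw [← intHomogeneousComponent_mul (hf j l)]
  congr 2
  ring

/-- Degree preserving maps out of graded free modules lift along degree preserving maps. -/
theorem exists_homogeneous_lift {r s : ℕ} {κ : Type*}
    (f : (Fin s → MvPolynomial (Fin n) k) →ₗ[MvPolynomial (Fin n) k] (κ → MvPolynomial (Fin n) k))
    (g : (Fin r → MvPolynomial (Fin n) k) →ₗ[MvPolynomial (Fin n) k] (κ → MvPolynomial (Fin n) k))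
    (b : Fin s → ℤ) (b' : κ → ℤ) (c : Fin r → ℤ)
    (hf : ∀ j l, IsHomogeneousOfIntDegree (f (Pi.single j 1) l) (b j - b' l))
    (hg : ∀ j l, IsHomogeneousOfIntDegree (g (Pi.single j 1) l) (c j - b' l))
    (hgf : LinearMap.range g ≤ LinearMap.range f) :
    ∃ φ : (Fin r → MvPolynomial (Fin n) k) →ₗ[MvPolynomial (Fin n) k]
        (Fin s → MvPolynomial (Fin n) k),
      f ∘ₗ φ = g ∧ ∀ j l, IsHomogeneousOfIntDegree (φ (Pi.single j 1) l) (c j - b l) := by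
  choose v hv hvh using fun j => exists_homogeneous_preimage f b b' hf (g (Pi.single j 1))
    (hgf ⟨_, rfl⟩) (c j) (hg j)
  refine ⟨(Pi.basisFun _ (Fin r)).constr (MvPolynomial (Fin n) k) v, ?_, fun j l => ?_⟩
  · refine (Pi.basisFun _ (Fin r)).ext fun j => ?_
    rw [LinearMap.comp_apply, Module.Basis.constr_basis, hv, Pi.basisFun_apply]
  · rw [← Pi.basisFun_apply, Module.Basis.constr_basis]
    exact hvh j l

theorem constantCoeff_map_eq_zero {r : ℕ} {κ : Type*}
    (f : (Fin r → MvPolynomial (Fin n) k) →ₗ[MvPolynomial (Fin n) k] (κ → MvPolynomial (Fin n) k))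
    {v : Fin r → MvPolynomial (Fin n) k} (hv : ∀ j, constantCoeff (v j) = 0) (l : κ) :
    constantCoeff (f v l) = 0 := by
  rw [linearMap_pi_apply_eq_sum, map_sum]
  exact Finset.sum_eq_zero fun j _ => by rw [map_mul, hv, zero_mul]

end Lifting

/-! ### Comparison of resolutions and independence of the regularity -/

namespace GradedFreeResolution

variable {k : Type*} [Field k] {n : ℕ} {I : Ideal (MvPolynomial (Fin n) k)}

theorem IsMinimal.constantCoeff_d {R : GradedFreeResolution I} (hR : R.IsMinimal) (i : ℕ)
    (v : Fin (R.rank (i + 1)) → MvPolynomial (Fin n) k) (l : Fin (R.rank i)) :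
    constantCoeff (R.d i v l) = 0 := by
  rw [linearMap_pi_apply_eq_sum, map_sum]
  exact Finset.sum_eq_zero fun j _ => by rw [map_mul, hR, mul_zero]

theorem d_comp_d (R : GradedFreeResolution I) (i : ℕ)
    (v : Fin (R.rank (i + 1 + 1)) → MvPolynomial (Fin n) k) : R.d i (R.d (i + 1) v) = 0 :=
  LinearMap.mem_ker.1 (R.exact_succ i ▸ ⟨v, rfl⟩)

theorem exists_comparison_zero (R R' : GradedFreeResolution I) :
    ∃ α : (Fin (R.rank 0) → MvPolynomial (Fin n) k) →ₗ[MvPolynomial (Fin n) k]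
        (Fin (R'.rank 0) → MvPolynomial (Fin n) k),
      (∀ j l, IsHomogeneousOfIntDegree (α (Pi.single j 1) l) (R.shift 0 j - R'.shift 0 l)) ∧
      ∀ v, R'.aug (α v) = R.aug v := by
  obtain ⟨α, h1, h2⟩ := exists_homogeneous_lift
    (LinearMap.pi fun _ : Unit => R'.aug) (LinearMap.pi fun _ : Unit => R.aug)
    (R'.shift 0) (fun _ => 0) (R.shift 0)
    (fun j _ => by simpa using R'.aug_homogeneous j) (fun j _ => by simpa using R.aug_homogeneous j)
    (by
      rintro _ ⟨v, rfl⟩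
      obtain ⟨w, hw⟩ : R.aug v ∈ LinearMap.range R'.aug := by
        rw [R'.range_aug]; exact R.range_aug.le ⟨v, rfl⟩
      exact ⟨w, by ext1; simpa using hw⟩)
  exact ⟨α, h2, fun v => congrFun (LinearMap.congr_fun h1 v) ()⟩

/-- One step of the inductive construction of a chain map; the last conclusion is the hypothesis
`hd` for the next step. -/
theorem exists_comparison_succ (R R' : GradedFreeResolution I) (i : ℕ)
    (α : (Fin (R.rank i) → MvPolynomial (Fin n) k) →ₗ[MvPolynomial (Fin n) k]
      (Fin (R'.rank i) → MvPolynomial (Fin n) k))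
    (hα : ∀ j l, IsHomogeneousOfIntDegree (α (Pi.single j 1) l) (R.shift i j - R'.shift i l))
    (hd : ∀ v, α (R.d i v) ∈ LinearMap.range (R'.d i)) :
    ∃ α' : (Fin (R.rank (i + 1)) → MvPolynomial (Fin n) k) →ₗ[MvPolynomial (Fin n) k]
        (Fin (R'.rank (i + 1)) → MvPolynomial (Fin n) k),
      (∀ j l, IsHomogeneousOfIntDegree (α' (Pi.single j 1) l)
        (R.shift (i + 1) j - R'.shift (i + 1) l)) ∧
      (∀ v, R'.d i (α' v) = α (R.d i v)) ∧
      ∀ v, α' (R.d (i + 1) v) ∈ LinearMap.range (R'.d (i + 1)) := by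
  obtain ⟨α', h1, h2⟩ := exists_homogeneous_lift (R'.d i) (α ∘ₗ R.d i)
    (R'.shift (i + 1)) (R'.shift i) (R.shift (i + 1)) (R'.d_homogeneous i)
    (fun j l => by
      rw [LinearMap.comp_apply, linearMap_pi_apply_eq_sum]
      refine IsHomogeneousOfIntDegree.sum fun p _ => ?_
      convert (R.d_homogeneous i j p).mul (hα p l) using 1
      ring)
    (by rintro _ ⟨v, rfl⟩; exact hd v)
  have h3 : ∀ v, R'.d i (α' v) = α (R.d i v) := LinearMap.congr_fun h1
  refine ⟨α', h2, h3, fun v => ?_⟩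
  rw [R'.exact_succ, LinearMap.mem_ker, h3, d_comp_d, map_zero]

/-- The comparison maps between two resolutions of the same ideal, the first of which is minimal,
together with a homotopy. -/
theorem exists_comparison {R : GradedFreeResolution I} (hR : R.IsMinimal)
    (R' : GradedFreeResolution I) (i : ℕ) :
    ∃ (α : (Fin (R.rank i) → MvPolynomial (Fin n) k) →ₗ[MvPolynomial (Fin n) k]
        (Fin (R'.rank i) → MvPolynomial (Fin n) k))
      (β : (Fin (R'.rank i) → MvPolynomial (Fin n) k) →ₗ[MvPolynomial (Fin n) k]
        (Fin (R.rank i) → MvPolynomial (Fin n) k))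
      (h : (Fin (R.rank i) → MvPolynomial (Fin n) k) →ₗ[MvPolynomial (Fin n) k]
        (Fin (R.rank (i + 1)) → MvPolynomial (Fin n) k)),
      (∀ j l, IsHomogeneousOfIntDegree (α (Pi.single j 1) l) (R.shift i j - R'.shift i l)) ∧
      (∀ v, α (R.d i v) ∈ LinearMap.range (R'.d i)) ∧
      (∀ j l, IsHomogeneousOfIntDegree (β (Pi.single j 1) l) (R'.shift i j - R.shift i l)) ∧
      (∀ v, β (R'.d i v) ∈ LinearMap.range (R.d i)) ∧
      (∀ v, β (α (R.d i v)) - R.d i v - R.d i (h (R.d i v)) = 0) ∧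
      ∀ v l, constantCoeff ((β (α v) - v - R.d i (h v)) l) = 0 := by
  -- The fifth condition carries the induction: it puts `β₁ α₁ - 1 - h d` into ker d = im d one
  -- degree up, where it lifts to the next homotopy. The sixth says that `β α` is the identity up to
  -- a boundary, modulo the maximal ideal.
  induction i with
  | zero =>
    obtain ⟨α, hα, hα'⟩ := exists_comparison_zero R R'
    obtain ⟨β, hβ, hβ'⟩ := exists_comparison_zero R' R
    obtain ⟨h, hh⟩ := Module.projective_lifting_property
      ((R.d 0).codRestrict (LinearMap.ker R.aug) fun v => R.exact_zero ▸ ⟨v, rfl⟩)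
      ((β ∘ₗ α - LinearMap.id).codRestrict (LinearMap.ker R.aug) fun v => by
        simp [hα', hβ'])
      (by
        rintro ⟨w, hw⟩
        rw [← R.exact_zero] at hw
        obtain ⟨v, rfl⟩ := hw
        exact ⟨v, rfl⟩)
    have hh' : ∀ v, R.d 0 (h v) = β (α v) - v := fun v =>
      congrArg Subtype.val (LinearMap.congr_fun hh v)
    refine ⟨α, β, h, hα, fun v => ?_, hβ, fun v => ?_, fun v => ?_, fun v l => ?_⟩
    · have : R.d 0 v ∈ LinearMap.ker R.aug := R.exact_zero ▸ ⟨v, rfl⟩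
      rw [R'.exact_zero, LinearMap.mem_ker, hα', this]
    · have : R'.d 0 v ∈ LinearMap.ker R'.aug := R'.exact_zero ▸ ⟨v, rfl⟩
      rw [R.exact_zero, LinearMap.mem_ker, hβ', this]
    · rw [hh', sub_self]
    · rw [hh', sub_self, Pi.zero_apply, map_zero]
  | succ i ih =>
    obtain ⟨α, β, h, hα, hα', hβ, hβ', h1, -⟩ := ih
    obtain ⟨α₁, hα₁, hαd, hα₁'⟩ := exists_comparison_succ R R' i α hα hα'
    obtain ⟨β₁, hβ₁, hβd, hβ₁'⟩ := exists_comparison_succ R' R i β hβ hβ'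
    obtain ⟨h₁, hh⟩ := Module.projective_lifting_property
      ((R.d (i + 1)).codRestrict (LinearMap.ker (R.d i)) fun v => R.exact_succ i ▸ ⟨v, rfl⟩)
      ((β₁ ∘ₗ α₁ - LinearMap.id - h ∘ₗ R.d i).codRestrict (LinearMap.ker (R.d i)) fun v => by
        simpa [hαd, hβd] using h1 v)
      (by
        rintro ⟨w, hw⟩
        rw [← R.exact_succ] at hw
        obtain ⟨v, rfl⟩ := hw
        exact ⟨v, rfl⟩)
    have hh' : ∀ v, R.d (i + 1) (h₁ v) = β₁ (α₁ v) - v - h (R.d i v) := fun v =>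
      congrArg Subtype.val (LinearMap.congr_fun hh v)
    refine ⟨α₁, β₁, h₁, hα₁, hα₁', hβ₁, hβ₁', fun v => ?_, fun v l => ?_⟩
    · rw [hh', d_comp_d, map_zero, sub_zero, sub_self]
    -- What remains is `h (d v)`, whose entries have no constant term because `R` is minimal.
    · rw [hh', sub_sub_cancel]
      exact constantCoeff_map_eq_zero h (hR.constantCoeff_d i v) l

/-- The shifts of a minimal resolution occur in every graded free resolution. -/
theorem IsMinimal.exists_shift_eq {R : GradedFreeResolution I} (hR : R.IsMinimal)
    (R' : GradedFreeResolution I) (i : ℕ) (j : Fin (R.rank i)) :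
    ∃ l, R'.shift i l = R.shift i j := by
  obtain ⟨α, β, h, hα, -, -, -, -, h2⟩ := exists_comparison hR R' i
  -- If no shift matched, every entry of `α e_j` would lack a constant term, hence so would `β α
  -- e_j`. As `d (h e_j)` lacks one too, coordinate `j` of `e_j`, which is 1, would have constant
  -- term zero.
  by_contra! hne
  have hα0 : ∀ l, constantCoeff (α (Pi.single j 1) l) = 0 := fun l => by
    by_contra h0
    have := (hα j l).eq_zero_of_constantCoeff_ne_zero h0
    exact hne l (by omega)
  have := h2 (Pi.single j 1) j
  simp [constantCoeff_map_eq_zero β hα0 j, hR.constantCoeff_d] at this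

theorem IsMinimal.maxShift_le {R : GradedFreeResolution I} (hR : R.IsMinimal)
    (R' : GradedFreeResolution I) : R.maxShift ≤ R'.maxShift := by
  refine Finset.sup_le fun i _ => Finset.sup_le fun j _ => ?_
  obtain ⟨l, hl⟩ := hR.exists_shift_eq R' i j
  have hi : i ≤ R'.length := by
    by_contra! hi
    have := R'.rank_eq_zero i hi
    have := l.2
    omega
  rw [← hl]
  exact (Finset.le_sup (f := fun l : Fin (R'.rank i) =>
    ((R'.shift i l - (i : ℤ) : ℤ) : WithBot ℤ)) (Finset.mem_univ l)).trans
    (Finset.le_sup (f := fun i => Finset.univ.sup fun l : Fin (R'.rank i) =>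
    ((R'.shift i l - (i : ℤ) : ℤ) : WithBot ℤ)) (Finset.mem_range.2 (by omega)))

theorem IsMinimal.castelnuovoMumfordReg_eq {R : GradedFreeResolution I} (hR : R.IsMinimal) :
    castelnuovoMumfordReg I = R.maxShift := by
  have h : HasMinimalResolution I := ⟨R, hR⟩
  rw [castelnuovoMumfordReg, dif_pos h]
  exact le_antisymm (h.choose_spec.maxShift_le R) (hR.maxShift_le _)

end GradedFreeResolution

/-! ### Multigraded resolutions encoded by scalars -/

open Matrix

/-- A multigraded free resolution of a monomial ideal of `k[x_1, …, x_n]` by finitely generated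
free modules, with basis `ι`, in terms of the scalars in its differential and augmentation. The
basis vector `j` has multidegree `deg j` and homological degree `hdeg j`; it is mapped to
`∑ l, D l j * x ^ (deg j - deg l) • l` by the differential and to `ε j * x ^ deg j` by the
augmentation. -/
structure MonomialResolution (k : Type*) [Field k] (n : ℕ) (ι : Type) [Fintype ι] where
  deg : ι → Fin n →₀ ℕ
  hdeg : ι → ℕ
  D : Matrix ι ι k
  ε : ι → k
  deg_le : ∀ {l j}, D l j ≠ 0 → deg l ≤ deg j
  hdeg_eq : ∀ {l j}, D l j ≠ 0 → hdeg j = hdeg l + 1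
  hdeg_eq_zero : ∀ {j}, ε j ≠ 0 → hdeg j = 0
  D_mulVec_D : ∀ v, D *ᵥ (D *ᵥ v) = 0
  ε_dotProduct_D : ∀ v, ε ⬝ᵥ (D *ᵥ v) = 0
  /-- Exactness in multidegree `b`. -/
  exact : ∀ b v, (∀ j, v j ≠ 0 → deg j ≤ b) → D *ᵥ v = 0 → ε ⬝ᵥ v = 0 →
    ∃ w, (∀ j, w j ≠ 0 → deg j ≤ b) ∧ D *ᵥ w = v

theorem exists_eq_sumElim {k ι κ : Type*} (v : ι ⊕ κ ⊕ ι → k) :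
    ∃ u t w, v = Sum.elim u (Sum.elim t w) :=
  ⟨v ∘ Sum.inl, v ∘ Sum.inr ∘ Sum.inl, v ∘ Sum.inr ∘ Sum.inr, by
    ext (_ | _ | _) <;> rfl⟩

namespace MonomialResolution

variable {k : Type*} [Field k] {n : ℕ}

section Basic

variable {ι : Type} [Fintype ι] (C : MonomialResolution k n ι)

/-- The exponents of the images of the basis vectors under the augmentation. -/
def exponents : Set (Fin n →₀ ℕ) := {a | ∃ j, C.ε j ≠ 0 ∧ C.deg j = a}

/-- The ideal resolved by a monomial resolution. -/
noncomputable def ideal : Ideal (MvPolynomial (Fin n) k) :=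
  Ideal.span ((fun a => monomial a (1 : k)) '' C.exponents)

theorem mem_ideal {x : MvPolynomial (Fin n) k} :
    x ∈ C.ideal ↔ ∀ a ∈ x.support, ∃ j, C.ε j ≠ 0 ∧ C.deg j ≤ a := by
  rw [ideal, mem_ideal_span_monomial_image]
  simp [exponents]

/-- A resolution is minimal if its differential has no entries of degree zero. -/
def IsMinimal : Prop := ∀ l j, C.D l j ≠ 0 → C.deg l ≠ C.deg j

/-- The maximum of the numbers `|deg j| - hdeg j`. -/
noncomputable def maxShift : WithBot ℤ :=
  Finset.univ.sup fun j => (((C.deg j).degree - C.hdeg j : ℤ) : WithBot ℤ)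

theorem le_maxShift (j : ι) : (((C.deg j).degree - C.hdeg j : ℤ) : WithBot ℤ) ≤ C.maxShift :=
  Finset.le_sup (f := fun j => (((C.deg j).degree - C.hdeg j : ℤ) : WithBot ℤ)) (Finset.mem_univ j)

theorem D_self (j : ι) : C.D j j = 0 := by
  by_contra h
  have := C.hdeg_eq h
  omega

theorem ε_eq_zero {p q : ι} (h : C.D q p ≠ 0) : C.ε p = 0 := by
  by_contra h'
  have := C.hdeg_eq_zero h'
  have := C.hdeg_eq h
  omega

end Basic

section Zero

/-- The resolution of the zero ideal. -/
noncomputable def zero (k : Type*) [Field k] (n : ℕ) : MonomialResolution k n Empty where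
  deg := Empty.elim
  hdeg := Empty.elim
  D := Matrix.of Empty.elim
  ε := Empty.elim
  deg_le {l} := l.elim
  hdeg_eq {l} := l.elim
  hdeg_eq_zero {l} := l.elim
  D_mulVec_D _ := Subsingleton.elim _ _
  ε_dotProduct_D _ := by simp [dotProduct]
  exact _ v _ _ _ := ⟨v, fun j => j.elim, Subsingleton.elim _ _⟩

end Zero

/-! ### Existence: adjoining a monomial by a mapping cone -/

section Adjoin

variable {ι : Type} [Fintype ι] [DecidableEq ι] (C : MonomialResolution k n ι)

/-- The differential of the mapping cone of the resolution of `C.ideal ∩ (x ^ m)` in the sum of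
those of `C.ideal` and `(x ^ m)`. -/
def adjoinD : Matrix (ι ⊕ Unit ⊕ ι) (ι ⊕ Unit ⊕ ι) k :=
  fromBlocks C.D (fromCols 0 1) 0 (fromBlocks 0 (Matrix.of fun _ j => -C.ε j) 0 (-C.D))

theorem adjoinD_mulVec (u : ι → k) (t : Unit → k) (w : ι → k) :
    C.adjoinD *ᵥ Sum.elim u (Sum.elim t w) =
      Sum.elim (C.D *ᵥ u + w) (Sum.elim (fun _ => -(C.ε ⬝ᵥ w)) (-(C.D *ᵥ w))) := by
  have : (Matrix.of fun (_ : Unit) j => -C.ε j) *ᵥ w = fun _ => -(C.ε ⬝ᵥ w) := by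
    ext
    simp [mulVec, dotProduct]
  rw [adjoinD, fromBlocks_mulVec, Sum.elim_comp_inl, Sum.elim_comp_inr, fromBlocks_mulVec,
    fromCols_mulVec_sumElim, Sum.elim_comp_inl, Sum.elim_comp_inr, this]
  simp [neg_mulVec]

/-- The resolution of `C.ideal + (x ^ m)` obtained from a resolution of `C.ideal`. -/
noncomputable def adjoin (m : Fin n →₀ ℕ) : MonomialResolution k n (ι ⊕ Unit ⊕ ι) where
  deg := Sum.elim C.deg (Sum.elim (fun _ => m) fun j => C.deg j ⊔ m)
  hdeg := Sum.elim C.hdeg (Sum.elim (fun _ => 0) fun j => C.hdeg j + 1)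
  D := C.adjoinD
  ε := Sum.elim C.ε (Sum.elim (fun _ => 1) 0)
  deg_le {l j} h := by
    rcases l with l | l | l <;> rcases j with j | j | j <;> simp [adjoinD, one_apply] at h ⊢
    · exact C.deg_le h
    · rw [h]; exact le_sup_left
    · exact le_sup_of_le_left (C.deg_le h)
  hdeg_eq {l j} h := by
    rcases l with l | l | l <;> rcases j with j | j | j <;> simp [adjoinD, one_apply] at h ⊢
    · exact C.hdeg_eq h
    · rw [h]
    · exact C.hdeg_eq_zero h
    · exact C.hdeg_eq h
  hdeg_eq_zero {j} h := by
    rcases j with j | j | j <;> simp at h ⊢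
    exact C.hdeg_eq_zero h
  D_mulVec_D v := by
    obtain ⟨u, t, w, rfl⟩ := exists_eq_sumElim v
    rw [adjoinD_mulVec, adjoinD_mulVec, mulVec_add, C.D_mulVec_D, mulVec_neg, C.D_mulVec_D,
      dotProduct_neg, C.ε_dotProduct_D]
    ext (_ | _ | _) <;> simp
  ε_dotProduct_D v := by
    obtain ⟨u, t, w, rfl⟩ := exists_eq_sumElim v
    rw [adjoinD_mulVec, sumElim_dotProduct_sumElim, sumElim_dotProduct_sumElim, dotProduct_add,
      C.ε_dotProduct_D]
    simp [dotProduct]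
  exact b v hv hD hε := by
    obtain ⟨u, t, w, rfl⟩ := exists_eq_sumElim v
    rw [adjoinD_mulVec] at hD
    have hDu : C.D *ᵥ u + w = 0 := funext fun j => congrFun hD (Sum.inl j)
    have hε' : C.ε ⬝ᵥ u + t () = 0 := by simpa [sumElim_dotProduct_sumElim, dotProduct] using hε
    -- If `m ≤ b`, the third summand is a full copy of the strand of `C`, and the cycle conditions
    -- say that `v` is the differential of `u` placed there. Otherwise only the first summand meets
    -- multidegree `b`, and exactness is that of `C`.
    by_cases hm : m ≤ b
    · refine ⟨Sum.elim 0 (Sum.elim 0 u), ?_, ?_⟩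
      · rintro (j | j | j) hj
        · exact absurd rfl hj
        · exact absurd rfl hj
        · exact sup_le (hv (Sum.inl j) hj) hm
      · rw [adjoinD_mulVec, mulVec_zero, zero_add, ← eq_neg_of_add_eq_zero_right hDu,
          ← eq_neg_of_add_eq_zero_right hε']
    · have ht : t = 0 := funext fun j => by
        by_contra h
        exact hm (hv (Sum.inr (Sum.inl j)) h)
      have hw : w = 0 := funext fun j => by
        by_contra h
        exact hm (le_sup_right.trans (hv (Sum.inr (Sum.inr j)) h))
      subst ht hw
      obtain ⟨w, hw, rfl⟩ := C.exact b u (fun j => hv (Sum.inl j)) (by simpa using hDu)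
        (by simpa using hε')
      refine ⟨Sum.elim w (Sum.elim 0 0), ?_, ?_⟩
      · rintro (j | j | j) hj
        · exact hw j hj
        · exact absurd rfl hj
        · exact absurd rfl hj
      · rw [adjoinD_mulVec, add_zero, mulVec_zero, dotProduct_zero, neg_zero, neg_zero]
        rfl

theorem exponents_adjoin (m : Fin n →₀ ℕ) : (C.adjoin m).exponents = insert m C.exponents := by
  ext a
  simp [exponents, adjoin, or_comm, eq_comm]

end Adjoin

theorem exists_exponents_eq (s : Finset (Fin n →₀ ℕ)) :
    ∃ (ι : Type) (_ : Fintype ι) (C : MonomialResolution k n ι), C.exponents = s := by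
  classical
  induction s using Finset.induction_on with
  | empty => exact ⟨Empty, inferInstance, zero k n, by ext; simp [exponents]⟩
  | insert m s _ ih =>
    obtain ⟨ι, _, C, hC⟩ := ih
    exact ⟨_, inferInstance, C.adjoin m, by rw [exponents_adjoin, hC, Finset.coe_insert]⟩

theorem exists_ideal_eq {I : Ideal (MvPolynomial (Fin n) k)} (hI : IsMonomialIdeal I) :
    ∃ (ι : Type) (_ : Fintype ι) (C : MonomialResolution k n ι), C.ideal = I := by
  classical
  obtain ⟨A, rfl⟩ := hI
  obtain ⟨t, ht, hA⟩ := (Submodule.fg_span_iff_fg_span_finset_subset _).1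
    (IsNoetherian.noetherian (Ideal.span ((fun a => monomial a (1 : k)) '' A)))
  obtain ⟨s, -, rfl⟩ := Finset.subset_set_image_iff.1 ht
  obtain ⟨ι, _, C, hC⟩ := exists_exponents_eq (k := k) s
  refine ⟨ι, _, C, ?_⟩
  rw [ideal, hC, ← Finset.coe_image]
  exact hA.symm

end MonomialResolution

/-! ### Minimality: cancelling a pair of basis vectors of equal multidegree -/

namespace MonomialResolution

variable {k : Type*} [Field k] {n : ℕ}

section Cancel

variable {ι : Type} [Fintype ι] [DecidableEq ι] (C : MonomialResolution k n ι) (p q : ι)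

/-- The extension of a vector by zero to `p` and `q`. -/
def cancelExtend : ({j // j ≠ p ∧ j ≠ q} → k) →ₗ[k] (ι → k) where
  toFun v j := if h : j ≠ p ∧ j ≠ q then v ⟨j, h⟩ else 0
  map_add' v w := by ext j; by_cases h : j ≠ p ∧ j ≠ q <;> simp [h]
  map_smul' c v := by ext j; by_cases h : j ≠ p ∧ j ≠ q <;> simp [h]

/-- The projection of `k^ι` with kernel spanned by the basis vector `p` and its differential, in
which the coefficient of `q` is nonzero. -/
def cancelProj : (ι → k) →ₗ[k] ({j // j ≠ p ∧ j ≠ q} → k) where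
  toFun v j := v j - v q * (C.D q p)⁻¹ * C.D j p
  map_add' v w := by ext j; simp only [Pi.add_apply]; ring
  map_smul' c v := by ext j; simp only [Pi.smul_apply, smul_eq_mul, RingHom.id_apply]; ring

variable {p q}

theorem sum_subtype_mul_eq (f : ι → k) (v : {j // j ≠ p ∧ j ≠ q} → k) :
    ∑ j : {j // j ≠ p ∧ j ≠ q}, f j * v j = ∑ j, f j * cancelExtend p q v j := by
  refine Fintype.sum_of_injective Subtype.val Subtype.val_injective _ _ (fun j hj => ?_)
    fun j => ?_
  · have : ¬(j ≠ p ∧ j ≠ q) := fun h => hj ⟨⟨j, h⟩, rfl⟩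
    rw [cancelExtend, LinearMap.coe_mk, AddHom.coe_mk, dif_neg this, mul_zero]
  · rw [cancelExtend, LinearMap.coe_mk, AddHom.coe_mk, dif_pos j.2]

theorem cancelProj_D_single (h : C.D q p ≠ 0) :
    C.cancelProj p q (C.D *ᵥ Pi.single p 1) = 0 := by
  ext j
  simp [cancelProj, mul_assoc, h]

theorem cancelProj_single : C.cancelProj p q (Pi.single p 1) = 0 := by
  ext j
  by_cases hqp : q = p
  · subst hqp
    simp [cancelProj, C.D_self, j.2.1]
  · simp [cancelProj, j.2.1, hqp]

theorem cancelProj_cancelExtend (v : {j // j ≠ p ∧ j ≠ q} → k) :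
    C.cancelProj p q (cancelExtend p q v) = v := by
  ext j
  simp [cancelProj, cancelExtend, j.2]

theorem cancelExtend_cancelProj (h : C.D q p ≠ 0) (v : ι → k) :
    cancelExtend p q (C.cancelProj p q v) =
      v - (v q * (C.D q p)⁻¹) • (C.D *ᵥ Pi.single p 1) - v p • Pi.single p 1 := by
  ext j
  have hqp : q ≠ p := fun e => h (by rw [e, C.D_self])
  by_cases hjp : j = p
  · subst hjp
    simp [cancelExtend, C.D_self]
  by_cases hjq : j = q
  · subst hjq
    simp [cancelExtend, hqp, h]
  · simp [cancelExtend, cancelProj, hjp, hjq]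

/-- The matrix of the differential after cancelling `p` and `q`. -/
def cancelD (p q : ι) : Matrix {j // j ≠ p ∧ j ≠ q} {j // j ≠ p ∧ j ≠ q} k :=
  Matrix.of fun l j => C.D l j - C.D q j * (C.D q p)⁻¹ * C.D l p

theorem cancelD_mulVec (v : {j // j ≠ p ∧ j ≠ q} → k) :
    C.cancelD p q *ᵥ v = C.cancelProj p q (C.D *ᵥ cancelExtend p q v) := by
  ext l
  simp only [cancelD, cancelProj, mulVec, dotProduct, of_apply, LinearMap.coe_mk, AddHom.coe_mk]
  rw [sum_subtype_mul_eq (fun j => C.D l j - C.D q j * (C.D q p)⁻¹ * C.D l p), Finset.sum_mul,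
    Finset.sum_mul, ← Finset.sum_sub_distrib]
  exact Finset.sum_congr rfl fun j _ => by ring

/-- The span of `e_p` and `D e_p` is a subcomplex and the kernel of `cancelProj`, so the projection
is a chain map onto the quotient. -/
theorem cancelD_mulVec_cancelProj (h : C.D q p ≠ 0) (v : ι → k) :
    C.cancelD p q *ᵥ C.cancelProj p q v = C.cancelProj p q (C.D *ᵥ v) := by
  rw [cancelD_mulVec, cancelExtend_cancelProj C h, mulVec_sub, mulVec_sub, mulVec_smul,
    mulVec_smul, C.D_mulVec_D, map_sub, map_sub, map_smul, map_smul, cancelProj_D_single C h]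
  simp

theorem ε_dotProduct_cancelExtend (v : {j // j ≠ p ∧ j ≠ q} → k) :
    (fun j => C.ε j : {j // j ≠ p ∧ j ≠ q} → k) ⬝ᵥ v = C.ε ⬝ᵥ cancelExtend p q v :=
  sum_subtype_mul_eq C.ε v

theorem ε_dotProduct_cancelProj (h : C.D q p ≠ 0) (v : ι → k) :
    (fun j => C.ε j : {j // j ≠ p ∧ j ≠ q} → k) ⬝ᵥ C.cancelProj p q v = C.ε ⬝ᵥ v := by
  rw [ε_dotProduct_cancelExtend, cancelExtend_cancelProj C h, dotProduct_sub, dotProduct_sub,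
    dotProduct_smul, dotProduct_smul, C.ε_dotProduct_D, dotProduct_single, C.ε_eq_zero h]
  simp

/-- The smaller resolution obtained by cancelling two basis vectors of the same multidegree. -/
noncomputable def cancel (h : C.D q p ≠ 0) (hpq : C.deg q = C.deg p) :
    MonomialResolution k n {j // j ≠ p ∧ j ≠ q} where
  deg j := C.deg j
  hdeg j := C.hdeg j
  D := C.cancelD p q
  ε j := C.ε j
  deg_le {l j} hlj := by
    -- A new entry comes from the zigzag `j → q ← p → l`, along which `deg l ≤ deg p = deg q ≤ deg
    -- j`.
    by_cases h1 : C.D l j = 0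
    · have h2 : C.D q j ≠ 0 := fun h2 => hlj (by simp [cancelD, h1, h2])
      have h3 : C.D l p ≠ 0 := fun h3 => hlj (by simp [cancelD, h1, h3])
      exact (C.deg_le h3).trans (hpq ▸ C.deg_le h2)
    · exact C.deg_le h1
  hdeg_eq {l j} hlj := by
    by_cases h1 : C.D l j = 0
    · have h2 : C.D q j ≠ 0 := fun h2 => hlj (by simp [cancelD, h1, h2])
      have h3 : C.D l p ≠ 0 := fun h3 => hlj (by simp [cancelD, h1, h3])
      have := C.hdeg_eq h
      have := C.hdeg_eq h2
      have := C.hdeg_eq h3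
      omega
    · exact C.hdeg_eq h1
  hdeg_eq_zero hj := C.hdeg_eq_zero hj
  D_mulVec_D v := by
    rw [cancelD_mulVec C v, C.cancelD_mulVec_cancelProj h, C.D_mulVec_D, map_zero]
  ε_dotProduct_D v := by
    rw [cancelD_mulVec, C.ε_dotProduct_cancelProj h, C.ε_dotProduct_D]
  exact b v hv hD hε := by
    have hext : ∀ j, cancelExtend p q v j ≠ 0 → C.deg j ≤ b := fun j hj => by
      by_cases hj' : j ≠ p ∧ j ≠ q
      · exact hv ⟨j, hj'⟩ (by simpa [cancelExtend, hj'] using hj)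
      · simp [cancelExtend, hj'] at hj
    set u := cancelExtend p q v with hu
    -- The lift `u` is a cycle only modulo the cancelled subcomplex. Applying `D` kills the `e_p`
    -- term, so `D u = β D e_p` and `u - β e_p` is a true cycle.
    have hDu : C.D *ᵥ u = ((C.D *ᵥ u) q * (C.D q p)⁻¹) • (C.D *ᵥ Pi.single p 1) +
        (C.D *ᵥ u) p • Pi.single p 1 := by
      have := cancelExtend_cancelProj C h (C.D *ᵥ u)
      rw [hu, ← cancelD_mulVec, hD, map_zero, sub_sub] at this
      exact sub_eq_zero.1 this.symm
    set β := (C.D *ᵥ u) q * (C.D q p)⁻¹ with hβ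
    have hDp : (C.D *ᵥ u) p = 0 := by
      have h1 := congrFun (congrArg (C.D *ᵥ ·) hDu) q
      simp only [C.D_mulVec_D, mulVec_add, mulVec_smul, smul_zero, zero_add] at h1
      simpa [h] using h1
    rw [hDp, zero_smul, add_zero] at hDu
    -- The correction stays in the strand: `β ≠ 0` makes `q` occur in `D u`, so `deg p = deg q ≤ b`.
    have hp : β ≠ 0 → C.deg p ≤ b := fun h0 => by
      have hq : (C.D *ᵥ u) q ≠ 0 := left_ne_zero_of_mul h0
      obtain ⟨j, -, hj⟩ := Finset.exists_ne_zero_of_sum_ne_zero hq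
      exact hpq ▸ (C.deg_le (left_ne_zero_of_mul hj)).trans (hext j (right_ne_zero_of_mul hj))
    obtain ⟨w, hw, hDw⟩ := C.exact b (u - β • Pi.single p 1)
      (fun j hj => by
        by_cases hu0 : u j = 0
        · by_cases hjp : j = p
          · subst hjp
            exact hp fun h0 => hj (by simp [hu0, h0])
          · exact absurd (by simp [hu0, hjp]) hj
        · exact hext j hu0)
      (by rw [mulVec_sub, mulVec_smul, ← hDu, sub_self])
      (by
        rw [dotProduct_sub, dotProduct_smul, dotProduct_single, C.ε_eq_zero h, hu,
          ← ε_dotProduct_cancelExtend, hε]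
        simp)
    refine ⟨C.cancelProj p q w, fun j hj => ?_, ?_⟩
    · by_cases h1 : w j = 0
      · have h2 : w q ≠ 0 := fun h2 => hj (by simp [cancelProj, h1, h2])
        have h3 : C.D j p ≠ 0 := fun h3 => hj (by simp [cancelProj, h1, h3])
        exact (C.deg_le h3).trans (hpq ▸ hw q h2)
      · exact hw j h1
    · rw [C.cancelD_mulVec_cancelProj h, hDw, map_sub, map_smul, cancelProj_single, smul_zero,
        sub_zero, hu, cancelProj_cancelExtend]

/-- If `ε q ≠ 0`, then `ε (D e_p) = 0` forces another `l` with `ε l * D l p ≠ 0`. Its monomial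
divides x^(deg q), so the generator at `q` is redundant. -/
theorem ideal_cancel (h : C.D q p ≠ 0) (hpq : C.deg q = C.deg p) :
    (C.cancel h hpq).ideal = C.ideal := by
  ext x
  rw [mem_ideal, mem_ideal]
  refine forall₂_congr fun a _ => ⟨fun ⟨j, hj⟩ => ⟨j, hj⟩, fun ⟨j, hj, hja⟩ => ?_⟩
  have hjp : j ≠ p := fun e => hj (e ▸ C.ε_eq_zero h)
  by_cases hjq : j = q
  · subst hjq
    have h0 := C.ε_dotProduct_D (Pi.single p 1)
    rw [mulVec_single_one] at h0
    change ∑ l, C.ε l * C.D l p = 0 at h0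
    obtain ⟨l, hl, hl0⟩ : ∃ l, l ≠ j ∧ C.ε l * C.D l p ≠ 0 := by
      by_contra! hl
      rw [Finset.sum_eq_single j (fun l _ => hl l) (by simp)] at h0
      exact mul_ne_zero hj h h0
    have hlp : l ≠ p := fun e => left_ne_zero_of_mul hl0 (e ▸ C.ε_eq_zero h)
    exact ⟨⟨l, hlp, hl⟩, left_ne_zero_of_mul hl0,
      (C.deg_le (right_ne_zero_of_mul hl0)).trans (hpq ▸ hja)⟩
  · exact ⟨⟨j, hjp, hjq⟩, hj, hja⟩

end Cancel

theorem exists_isMinimal_of_card (N : ℕ) : ∀ {ι : Type} [Fintype ι] (C : MonomialResolution k n ι),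
    Fintype.card ι = N → ∃ (κ : Type) (_ : Fintype κ) (C' : MonomialResolution k n κ),
      C'.ideal = C.ideal ∧ C'.IsMinimal := by
  classical
  induction N using Nat.strong_induction_on with
  | _ N ih =>
    intro ι _ C hN
    by_cases hC : C.IsMinimal
    · exact ⟨ι, _, C, rfl, hC⟩
    · simp only [IsMinimal, not_forall, not_not] at hC
      obtain ⟨q, p, h, hpq⟩ := hC
      obtain ⟨κ, _, C', h1, h2⟩ := ih _
        (hN ▸ Fintype.card_subtype_lt (x := p) (by simp)) (C.cancel h hpq) rfl
      exact ⟨κ, _, C', h1.trans (C.ideal_cancel h hpq), h2⟩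

/-- Every monomial ideal has a minimal multigraded free resolution. -/
theorem exists_isMinimal {I : Ideal (MvPolynomial (Fin n) k)} (hI : IsMonomialIdeal I) :
    ∃ (ι : Type) (_ : Fintype ι) (C : MonomialResolution k n ι), C.ideal = I ∧ C.IsMinimal := by
  obtain ⟨ι, _, C, rfl⟩ := exists_ideal_eq hI
  exact exists_isMinimal_of_card _ C rfl

end MonomialResolution

/-! ### Contracting a strand onto its homology -/

open scoped Kronecker

namespace MonomialResolution

variable {k : Type*} [Field k] {n : ℕ}

section Homotopy

variable {ι : Type} [Fintype ι] [DecidableEq ι] (C : MonomialResolution k n ι)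

open Classical in
/-- The projection to the part of multidegree `b`. -/
noncomputable def trunc (b : Fin n →₀ ℕ) : Matrix ι ι k :=
  diagonal fun j => if C.deg j ≤ b then 1 else 0

/-- The diagonal matrix of the signs `(-1) ^ hdeg j`. -/
def sign : Matrix ι ι k := diagonal fun j => (-1) ^ C.hdeg j

variable (b : Fin n →₀ ℕ)

theorem trunc_mulVec_eq_iff (v : ι → k) :
    C.trunc b *ᵥ v = v ↔ ∀ j, v j ≠ 0 → C.deg j ≤ b := by
  rw [_root_.funext_iff]
  refine forall_congr' fun j => ?_
  rw [trunc, mulVec_diagonal]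
  by_cases h : C.deg j ≤ b <;> simp [h, eq_comm]

theorem trunc_mul_trunc : C.trunc b * C.trunc b = C.trunc b := by
  simp [trunc, diagonal_mul_diagonal]

theorem trunc_mul_D_mul_trunc : C.trunc b * (C.D * C.trunc b) = C.D * C.trunc b := by
  ext l j
  rw [trunc, diagonal_mul, mul_diagonal]
  by_cases h : C.D l j = 0
  · simp [h]
  · by_cases hj : C.deg j ≤ b
    · simp [hj, (C.deg_le h).trans hj]
    · simp [hj]

theorem D_mul_D : C.D * C.D = 0 :=
  ext_of_mulVec_single fun j => by rw [← mulVec_mulVec, C.D_mulVec_D, zero_mulVec]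

theorem sign_mul_trunc : C.sign * C.trunc b = C.trunc b * C.sign := by
  simp [sign, trunc, diagonal_mul_diagonal, mul_comm]

theorem D_mul_sign : C.D * C.sign = -(C.sign * C.D) := by
  ext l j
  rw [sign, Matrix.neg_apply, diagonal_mul, mul_diagonal]
  by_cases h : C.D l j = 0
  · simp [h]
  · rw [C.hdeg_eq h]
    ring

/-- A cycle representing a generator of the homology in multidegree `b`. -/
theorem exists_section : ∃ η : ι → k, C.trunc b *ᵥ η = η ∧ C.D *ᵥ η = 0 ∧
    (∀ j, η j ≠ 0 → C.hdeg j = 0) ∧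
    ∀ v, C.ε ⬝ᵥ (C.trunc b *ᵥ v) * C.ε ⬝ᵥ η = C.ε ⬝ᵥ (C.trunc b *ᵥ v) := by
  -- Either x^b is in the ideal and `ε η = 1`, or `ε` vanishes on the strand and `η = 0`; the last
  -- condition covers both.
  by_cases h : ∃ j, C.ε j ≠ 0 ∧ C.deg j ≤ b
  · obtain ⟨j, hj, hjb⟩ := h
    refine ⟨Pi.single j (C.ε j)⁻¹, ?_, ?_, fun i hi => ?_, fun v => ?_⟩
    · rw [trunc_mulVec_eq_iff]
      intro i hi
      by_cases hij : i = j
      · rwa [hij]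
      · simp [hij] at hi
    · ext l
      rw [mulVec_single]
      have : C.D l j = 0 := by
        by_contra h
        have := C.hdeg_eq h
        have := C.hdeg_eq_zero hj
        omega
      simp [this]
    · by_cases hij : i = j
      · rw [hij, C.hdeg_eq_zero hj]
      · simp [hij] at hi
    · rw [dotProduct_single, mul_inv_cancel₀ hj, mul_one]
  · refine ⟨0, mulVec_zero _, mulVec_zero _, fun j hj => absurd rfl hj, fun v => ?_⟩
    rw [dotProduct_zero, mul_zero, eq_comm]
    refine Finset.sum_eq_zero fun j _ => ?_
    rw [trunc, mulVec_diagonal]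
    by_cases hj : C.deg j ≤ b
    · have : C.ε j = 0 := by
        by_contra h0
        exact h ⟨j, h0, hj⟩
      rw [this, zero_mul]
    · simp [hj]

/-- The projection of the part of multidegree `b` to its homology. -/
noncomputable def homologyProj (η : ι → k) : Matrix ι ι k := vecMulVec η C.ε * C.trunc b

theorem homologyProj_mulVec (η v : ι → k) :
    C.homologyProj b η *ᵥ v = (C.ε ⬝ᵥ (C.trunc b *ᵥ v)) • η := by
  rw [homologyProj, ← mulVec_mulVec, vecMulVec_mulVec]
  simp

theorem homologyProj_mul_trunc (η : ι → k) :
    C.homologyProj b η * C.trunc b = C.homologyProj b η := by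
  rw [homologyProj, mul_assoc, trunc_mul_trunc]

theorem homologyProj_mul_D (η : ι → k) : C.homologyProj b η * (C.D * C.trunc b) = 0 := by
  refine ext_of_mulVec_single fun j => ?_
  rw [← mulVec_mulVec, homologyProj_mulVec, mulVec_mulVec, trunc_mul_D_mul_trunc, ← mulVec_mulVec,
    C.ε_dotProduct_D, zero_smul, zero_mulVec]

theorem homologyProj_mul_sign (η : ι → k) :
    C.homologyProj b η * C.sign = C.homologyProj b η := by
  ext l j
  rw [homologyProj, trunc, sign, mul_diagonal, mul_diagonal, vecMulVec_apply]
  by_cases h : C.ε j = 0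
  · simp [h]
  · simp [C.hdeg_eq_zero h]

theorem sign_mul_homologyProj {η : ι → k} (hη : ∀ j, η j ≠ 0 → C.hdeg j = 0) :
    C.sign * C.homologyProj b η = C.homologyProj b η := by
  ext l j
  rw [homologyProj, trunc, sign, diagonal_mul, mul_diagonal, vecMulVec_apply]
  by_cases h : η l = 0
  · simp [h]
  · simp [hη l h]

/-- Over a field `D` has a section `T` on its image, corrected here so that `ε T = 0`. The values of
`X = E - T D E - P` are cycles killed by `ε`, hence boundaries. So `s = T X` satisfies `D s = X`
however `T` was extended, and `s D E = T D E`; the two add up to `E - P`. -/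
theorem exists_ungraded_homotopy {η : ι → k} (hη : C.trunc b *ᵥ η = η) (hDη : C.D *ᵥ η = 0)
    (hεη : ∀ v, C.ε ⬝ᵥ (C.trunc b *ᵥ v) * C.ε ⬝ᵥ η = C.ε ⬝ᵥ (C.trunc b *ᵥ v)) :
    ∃ s : Matrix ι ι k, C.trunc b * s = s ∧ s * C.trunc b = s ∧
      C.D * s + s * (C.D * C.trunc b) = C.trunc b - C.homologyProj b η := by
  set E := C.trunc b with hE
  set P := C.homologyProj b η with hP
  have hEE : E * E = E := C.trunc_mul_trunc b
  have hEDE : E * (C.D * E) = C.D * E := C.trunc_mul_D_mul_trunc b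
  have hPE : P * E = P := C.homologyProj_mul_trunc b η
  have hPDE : P * (C.D * E) = 0 := C.homologyProj_mul_D b η
  have hEP : E * P = P := ext_of_mulVec_single fun j => by
    rw [← mulVec_mulVec, homologyProj_mulVec, mulVec_smul, hη]
  have hDP : C.D * P = 0 := ext_of_mulVec_single fun j => by
    rw [← mulVec_mulVec, homologyProj_mulVec, mulVec_smul, hDη, smul_zero, zero_mulVec]
  obtain ⟨g, hg⟩ := (mulVecLin (C.D * E)).rangeRestrict.exists_rightInverse_of_surjective
    (LinearMap.range_rangeRestrict _)
  obtain ⟨g', hg'⟩ := LinearMap.exists_extend g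
  set T := (E - P) * LinearMap.toMatrix' g' with hT
  have hET : E * T = T := by rw [hT, ← mul_assoc, mul_sub, hEE, hEP]
  have hDT : ∀ v, C.D *ᵥ (T *ᵥ ((C.D * E) *ᵥ v)) = (C.D * E) *ᵥ v := fun v => by
    have h1 : g' ((C.D * E) *ᵥ v) = g ⟨_, ⟨v, rfl⟩⟩ := LinearMap.congr_fun hg' ⟨_, ⟨v, rfl⟩⟩
    have h2 : (C.D * E) *ᵥ g ⟨_, ⟨v, rfl⟩⟩ = (C.D * E) *ᵥ v :=
      congrArg Subtype.val (LinearMap.congr_fun hg ⟨_, ⟨v, rfl⟩⟩)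
    rw [mulVec_mulVec, hT, ← mul_assoc, mul_sub, hDP, sub_zero, ← mulVec_mulVec,
      LinearMap.toMatrix'_mulVec, h1, h2]
  have hDTDE : C.D * (T * (C.D * E)) = C.D * E := ext_of_mulVec_single fun j => by
    rw [← mulVec_mulVec, ← mulVec_mulVec, hDT]
  have hεT : ∀ v, C.ε ⬝ᵥ (T *ᵥ v) = 0 := fun v => by
    rw [hT, ← mulVec_mulVec, sub_mulVec, homologyProj_mulVec, dotProduct_sub, dotProduct_smul,
      smul_eq_mul, hεη, sub_self]
  set X := E - T * (C.D * E) - P with hX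
  have hDX : C.D * X = 0 := by rw [hX, mul_sub, mul_sub, hDTDE, hDP, sub_self, sub_zero]
  have hEX : E * X = X := by rw [hX, mul_sub, mul_sub, ← mul_assoc, hET, hEE, hEP]
  have hεX : ∀ v, C.ε ⬝ᵥ (X *ᵥ v) = 0 := fun v => by
    rw [hX, sub_mulVec, sub_mulVec, ← mulVec_mulVec, dotProduct_sub, dotProduct_sub, hεT,
      homologyProj_mulVec, dotProduct_smul, smul_eq_mul, hεη, sub_zero, sub_self]
  have hDTX : C.D * (T * X) = X := ext_of_mulVec_single fun j => by
    obtain ⟨w, hw, hDw⟩ := C.exact b (X *ᵥ Pi.single j 1)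
      ((C.trunc_mulVec_eq_iff b _).1 (by rw [mulVec_mulVec, hEX]))
      (by rw [mulVec_mulVec, hDX, zero_mulVec]) (hεX _)
    have hw' : (C.D * E) *ᵥ w = X *ᵥ Pi.single j 1 := by
      rw [← mulVec_mulVec, (C.trunc_mulVec_eq_iff b w).2 hw, hDw]
    rw [← mulVec_mulVec, ← mulVec_mulVec, ← hw', hDT]
  have hXDE : X * (C.D * E) = C.D * E := by
    have h0 : C.D * E * (C.D * E) = 0 := by
      rw [mul_assoc, hEDE, ← mul_assoc, C.D_mul_D, zero_mul]
    rw [hX, sub_mul, sub_mul, hPDE, mul_assoc, h0, hEDE, mul_zero, sub_zero, sub_zero]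
  refine ⟨T * X, by rw [← mul_assoc, hET], ?_, ?_⟩
  · rw [mul_assoc T, hX, sub_mul, sub_mul, hEE, hPE, mul_assoc T, mul_assoc C.D, hEE]
  · rw [hDTX, mul_assoc, hXDE, hX]
    abel

theorem exists_homotopy : ∃ (s : Matrix ι ι k) (η : ι → k),
    C.trunc b * s = s ∧ s * C.trunc b = s ∧ C.sign * s = -(s * C.sign) ∧
    C.D * s + s * (C.D * C.trunc b) = C.trunc b - C.homologyProj b η ∧
    C.D * C.homologyProj b η = 0 ∧ C.sign * C.homologyProj b η = C.homologyProj b η := by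
  obtain ⟨η, hη, hDη, hη0, hεη⟩ := C.exists_section b
  obtain ⟨s, h1, h2, h3⟩ := C.exists_ungraded_homotopy b hη hDη hεη
  -- Keep the part of `s` raising `hdeg` by one. The homotopy identity survives since `D` lowers
  -- `hdeg` by one while `trunc` and `homologyProj` preserve it.
  refine ⟨Matrix.of fun l j => if C.hdeg l = C.hdeg j + 1 then s l j else 0, η, ?_, ?_, ?_, ?_, ?_,
    C.sign_mul_homologyProj b hη0⟩
  · ext l j
    have := congrFun (congrFun h1 l) j
    rw [trunc, diagonal_mul] at this ⊢
    simp only [of_apply]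
    by_cases h : C.hdeg l = C.hdeg j + 1
    · rw [if_pos h, this]
    · rw [if_neg h, mul_zero]
  · ext l j
    have := congrFun (congrFun h2 l) j
    rw [trunc, mul_diagonal] at this ⊢
    simp only [of_apply]
    by_cases h : C.hdeg l = C.hdeg j + 1
    · rw [if_pos h, this]
    · rw [if_neg h, zero_mul]
  · ext l j
    rw [sign, Matrix.neg_apply, diagonal_mul, mul_diagonal]
    simp only [of_apply]
    split_ifs with h
    · rw [h]; ring
    · simp
  · ext l j
    have h := congrFun (congrFun h3 l) j
    rw [Matrix.add_apply, Matrix.mul_apply, Matrix.mul_apply] at h ⊢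
    by_cases hlj : C.hdeg l = C.hdeg j
    · rw [← h]
      congr 1
      · refine Finset.sum_congr rfl fun i _ => ?_
        by_cases hD : C.D l i = 0
        · simp [hD]
        · simp [C.hdeg_eq hD, hlj]
      · refine Finset.sum_congr rfl fun i _ => ?_
        rw [trunc, mul_diagonal]
        by_cases hD : C.D i j = 0
        · simp [hD]
        · simp [← C.hdeg_eq hD, hlj]
    · have hne : l ≠ j := fun e => hlj (by rw [e])
      rw [Finset.sum_eq_zero, Finset.sum_eq_zero, Matrix.sub_apply, homologyProj, trunc,
        diagonal_apply_ne _ hne, mul_diagonal, vecMulVec_apply]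
      · by_cases hl : η l = 0
        · simp [hl]
        · by_cases hj : C.ε j = 0
          · simp [hj]
          · exact absurd ((hη0 l hl).trans (C.hdeg_eq_zero hj).symm) hlj
      · intro i _
        rw [trunc, mul_diagonal]
        by_cases hD : C.D i j = 0
        · simp [hD]
        · simp [← C.hdeg_eq hD, hlj]
      · intro i _
        by_cases hD : C.D l i = 0
        · simp [hD]
        · simp [C.hdeg_eq hD, hlj]
  · exact ext_of_mulVec_single fun j => by
      rw [← mulVec_mulVec, homologyProj_mulVec, mulVec_smul, hDη, smul_zero, zero_mulVec]

end Homotopy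

/-! ### The tensor product with joined degrees, resolving an intersection -/

section Inter

variable {ι κ : Type} [Fintype ι] [Fintype κ] [DecidableEq ι] [DecidableEq κ]
  (C : MonomialResolution k n ι) (C' : MonomialResolution k n κ)

/-- The differential of the tensor product. -/
def interD : Matrix (ι × κ) (ι × κ) k := C.D ⊗ₖ 1 + C.sign ⊗ₖ C'.D

theorem interD_ne_zero {x y : ι × κ} (h : interD C C' x y ≠ 0) :
    (C.D x.1 y.1 ≠ 0 ∧ x.2 = y.2) ∨ (x.1 = y.1 ∧ C'.D x.2 y.2 ≠ 0) := by
  contrapose! h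
  rw [interD, Matrix.add_apply, kronecker_apply, kronecker_apply, sign, one_apply, diagonal_apply]
  by_cases h1 : C.D x.1 y.1 = 0
  · by_cases h2 : x.1 = y.1
    · simp [h1, h.2 h2]
    · simp [h1, h2]
  · have hD : ¬x.1 = y.1 := fun e => h1 (by rw [e, C.D_self])
    simp [h.1 h1, hD]

theorem interD_mul_interD : interD C C' * interD C C' = 0 := by
  rw [interD, mul_add, add_mul, add_mul, ← mul_kronecker_mul, ← mul_kronecker_mul,
    ← mul_kronecker_mul, ← mul_kronecker_mul, C.D_mul_D, C'.D_mul_D, C.D_mul_sign, one_mul, mul_one,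
    ← neg_one_smul k (C.sign * C.D), smul_kronecker]
  simp

theorem of_ε_mul_D : (Matrix.of fun (_ : Unit) j => C.ε j) * C.D = 0 := by
  refine ext_of_mulVec_single fun j => ?_
  rw [← mulVec_mulVec]
  ext
  simpa [mulVec, dotProduct] using C.ε_dotProduct_D (Pi.single j 1)

/-- A join is ≤ `b` iff both terms are: the strand at `b` is the tensor product of the strands. -/
theorem trunc_kronecker_trunc (b : Fin n →₀ ℕ) :
    C.trunc b ⊗ₖ C'.trunc b =
      diagonal fun j : ι × κ => (open Classical in if C.deg j.1 ⊔ C'.deg j.2 ≤ b then 1 else 0) := by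
  rw [trunc, trunc, diagonal_kronecker_diagonal]
  congr 1
  ext j
  by_cases h1 : C.deg j.1 ≤ b <;> by_cases h2 : C'.deg j.2 ≤ b <;> simp [h1, h2]

theorem exists_inter_homotopy (b : Fin n →₀ ℕ) : ∃ (s : Matrix (ι × κ) (ι × κ) k)
    (η : ι → k) (η' : κ → k), (C.trunc b ⊗ₖ C'.trunc b) * s = s ∧
    interD C C' * s + s * (interD C C' * (C.trunc b ⊗ₖ C'.trunc b)) =
      C.trunc b ⊗ₖ C'.trunc b - C.homologyProj b η ⊗ₖ C'.homologyProj b η' := by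
  obtain ⟨s, η, hEs, hsE, hσs, hs, hDP, hσP⟩ := C.exists_homotopy b
  obtain ⟨s', η', hEs', hsE', hσs', hs', hDP', hσP'⟩ := C'.exists_homotopy b
  set E := C.trunc b with hE
  set E' := C'.trunc b with hE'
  set P := C.homologyProj b η with hP
  set P' := C'.homologyProj b η' with hP'
  have hEE' : E' * E' = E' := C'.trunc_mul_trunc b
  have hEDE' : E' * (C'.D * E') = C'.D * E' := C'.trunc_mul_D_mul_trunc b
  have hPDE : P * (C.D * E) = 0 := C.homologyProj_mul_D b η
  have hPE : P * E = P := C.homologyProj_mul_trunc b η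
  have hPσ : P * C.sign = P := C.homologyProj_mul_sign b η
  have hσE : C.sign * E = E * C.sign := C.sign_mul_trunc b
  have hEP : E * P = P := by
    have h := congrArg (E * ·) hs
    have hEE : E * E = E := C.trunc_mul_trunc b
    have hEDs : E * (C.D * s) = C.D * s := by
      rw [← hEs, ← mul_assoc C.D, ← mul_assoc E, C.trunc_mul_D_mul_trunc b]
    simp only [mul_add, mul_sub, hEE, hEDs] at h
    rw [← mul_assoc E s, hEs, hs] at h
    exact (sub_right_injective h).symm
  -- Contract the first factor, then the second: `E ⊗ E'` to `P ⊗ E'` to `P ⊗ P'`. Mixed terms in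
  -- `s` cancel because `s` anticommutes with `sign`; those in `P` need no sign, as `P` lives in
  -- homological degree 0.
  refine ⟨s ⊗ₖ E' + P ⊗ₖ s', η, η', ?_, ?_⟩
  · rw [mul_add, ← mul_kronecker_mul, ← mul_kronecker_mul, hEs, hEE', hEP, hEs']
  · have h1 : s ⊗ₖ E' * (C.D * E) ⊗ₖ E' = (s * (C.D * E)) ⊗ₖ E' := by
      rw [← mul_kronecker_mul, hEE']
    have h2 : s ⊗ₖ E' * (C.sign * E) ⊗ₖ (C'.D * E') = (s * C.sign) ⊗ₖ (C'.D * E') := by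
      rw [← mul_kronecker_mul, hEDE', hσE, ← mul_assoc, hsE]
    have h3 : P ⊗ₖ s' * (C.D * E) ⊗ₖ E' = 0 := by
      rw [← mul_kronecker_mul, hPDE, zero_kronecker]
    have h4 : P ⊗ₖ s' * (C.sign * E) ⊗ₖ (C'.D * E') = P ⊗ₖ (s' * (C'.D * E')) := by
      rw [← mul_kronecker_mul, ← mul_assoc P, hPσ, hPE]
    have h5 : (C.D * s) ⊗ₖ E' + (s * (C.D * E)) ⊗ₖ E' = (E - P) ⊗ₖ E' := by
      rw [← add_kronecker, hs]
    have h6 : P ⊗ₖ (C'.D * s') + P ⊗ₖ (s' * (C'.D * E')) = P ⊗ₖ (E' - P') := by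
      rw [← kronecker_add, hs']
    have h7 : (C.sign * s) ⊗ₖ (C'.D * E') = -((s * C.sign) ⊗ₖ (C'.D * E')) := by
      rw [hσs, ← neg_one_smul k (s * C.sign), smul_kronecker, neg_one_smul]
    have h8 : (E - P) ⊗ₖ E' + P ⊗ₖ (E' - P') = E ⊗ₖ E' - P ⊗ₖ P' := by
      ext ⟨x, x'⟩ ⟨y, y'⟩
      simp only [Matrix.add_apply, Matrix.sub_apply, kronecker_apply]
      ring
    change _ = E ⊗ₖ E' - P ⊗ₖ P'
    rw [interD, add_mul (C.D ⊗ₖ 1), add_mul (C.D ⊗ₖ 1), ← mul_kronecker_mul, ← mul_kronecker_mul,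
      mul_add, mul_add, ← mul_kronecker_mul, ← mul_kronecker_mul, ← mul_kronecker_mul,
      ← mul_kronecker_mul, one_mul, one_mul, hDP, zero_kronecker, hσP, mul_add, add_mul,
      add_mul, h1, h2, h3, h4, h7, ← h8, ← h5, ← h6]
    abel

/-- The resolution of the intersection of two monomial ideals whose part of multidegree `b` is the
tensor product of the parts of multidegree `b` of the two given resolutions. -/
noncomputable def inter : MonomialResolution k n (ι × κ) where
  deg x := C.deg x.1 ⊔ C'.deg x.2
  hdeg x := C.hdeg x.1 + C'.hdeg x.2
  D := interD C C'
  ε x := C.ε x.1 * C'.ε x.2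
  deg_le {x y} h := by
    rcases interD_ne_zero C C' h with ⟨h1, h2⟩ | ⟨h1, h2⟩
    · rw [h2]; exact sup_le_sup_right (C.deg_le h1) _
    · rw [h1]; exact sup_le_sup_left (C'.deg_le h2) _
  hdeg_eq {x y} h := by
    rcases interD_ne_zero C C' h with ⟨h1, h2⟩ | ⟨h1, h2⟩
    · rw [h2, C.hdeg_eq h1]; ring
    · rw [h1, C'.hdeg_eq h2]; ring
  hdeg_eq_zero {x} h := by
    rw [C.hdeg_eq_zero (left_ne_zero_of_mul h), C'.hdeg_eq_zero (right_ne_zero_of_mul h)]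
  D_mulVec_D v := by rw [mulVec_mulVec, interD_mul_interD, zero_mulVec]
  ε_dotProduct_D v := by
    have h : (Matrix.of fun (_ : Unit) j => C.ε j) ⊗ₖ (Matrix.of fun (_ : Unit) j => C'.ε j) *
        interD C C' = 0 := by
      rw [interD, Matrix.mul_add, ← mul_kronecker_mul, ← mul_kronecker_mul, of_ε_mul_D, of_ε_mul_D,
        zero_kronecker, kronecker_zero, add_zero]
    have h' := congrFun (congrArg (· *ᵥ v) h) ((), ())
    simp only [← mulVec_mulVec, zero_mulVec] at h'
    exact h'
  exact b v hv hD hε := by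
    obtain ⟨s, η, η', hs, h⟩ := exists_inter_homotopy C C' b
    have hfix : ∀ u : ι × κ → k, (C.trunc b ⊗ₖ C'.trunc b) *ᵥ u = u ↔
        ∀ x, u x ≠ 0 → C.deg x.1 ⊔ C'.deg x.2 ≤ b := fun u => by
      rw [_root_.funext_iff]
      refine forall_congr' fun x => ?_
      rw [trunc_kronecker_trunc, mulVec_diagonal]
      by_cases hx : C.deg x.1 ⊔ C'.deg x.2 ≤ b <;> simp [hx, eq_comm]
    have hEv := (hfix v).2 hv
    refine ⟨s *ᵥ v, (hfix _).1 (by rw [mulVec_mulVec, hs]), ?_⟩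
    -- `P ⊗ P'` factors through the product augmentation, which kills `v`; the homotopy then reads
    -- `v = D (s v)`.
    have hP : (C.homologyProj b η ⊗ₖ C'.homologyProj b η') *ᵥ v = 0 := by
      rw [homologyProj, homologyProj, mul_kronecker_mul, ← mulVec_mulVec, hEv]
      ext x
      have : ∀ y, (vecMulVec η C.ε ⊗ₖ vecMulVec η' C'.ε) x y * v y =
          η x.1 * η' x.2 * ((C.ε y.1 * C'.ε y.2) * v y) := fun y => by
        rw [kronecker_apply, vecMulVec_apply, vecMulVec_apply]
        ring
      simp only [mulVec, dotProduct] at hε ⊢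
      rw [Finset.sum_congr rfl fun y _ => this y, ← Finset.mul_sum, hε, mul_zero, Pi.zero_apply]
    have h' := congrArg (· *ᵥ v) h
    simp only [add_mulVec, sub_mulVec, ← mulVec_mulVec, hEv, hD, hP, mulVec_zero, add_zero,
      sub_zero] at h'
    exact h'

theorem ideal_inter : (inter C C').ideal = C.ideal ⊓ C'.ideal := by
  ext x
  rw [Submodule.mem_inf, mem_ideal, mem_ideal, mem_ideal, ← forall₂_and]
  refine forall₂_congr fun a _ => ⟨fun ⟨j, hj, hja⟩ => ⟨⟨j.1, left_ne_zero_of_mul hj,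
    le_sup_left.trans hja⟩, ⟨j.2, right_ne_zero_of_mul hj, le_sup_right.trans hja⟩⟩,
    fun ⟨⟨j, hj, hja⟩, ⟨l, hl, hla⟩⟩ => ⟨(j, l), mul_ne_zero hj hl, sup_le hja hla⟩⟩

theorem maxShift_inter_le : (inter C C').maxShift ≤ C.maxShift + C'.maxShift := by
  refine Finset.sup_le fun x _ => le_trans ?_ (add_le_add (C.le_maxShift x.1) (C'.le_maxShift x.2))
  rw [← WithBot.coe_add, WithBot.coe_le_coe]
  have h : (C.deg x.1 ⊔ C'.deg x.2).degree ≤ (C.deg x.1).degree + (C'.deg x.2).degree := by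
    rw [← map_add]
    exact Finsupp.degree_mono (sup_le le_self_add le_add_self)
  simp only [inter]
  push_cast
  omega

end Inter

/-! ### Finite intersections -/

/-- The resolution of the unit ideal. -/
noncomputable def unit (k : Type*) [Field k] (n : ℕ) : MonomialResolution k n Unit where
  deg _ := 0
  hdeg _ := 0
  D := 0
  ε _ := 1
  deg_le h := absurd rfl h
  hdeg_eq h := absurd rfl h
  hdeg_eq_zero _ := rfl
  D_mulVec_D _ := by simp
  ε_dotProduct_D _ := by simp
  exact b v _ _ h := ⟨0, fun j hj => absurd rfl hj, by
    ext
    simpa [dotProduct] using h.symm⟩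

theorem ideal_unit : (unit k n).ideal = ⊤ := by
  ext x
  simp [mem_ideal, unit]

theorem maxShift_unit : (unit k n).maxShift = 0 := by
  simp [maxShift, unit]

theorem exists_ideal_eq_iInf {d : Type*} (s : Finset d) (ι : d → Type) [∀ i, Fintype (ι i)]
    (C : ∀ i, MonomialResolution k n (ι i)) :
    ∃ (κ : Type) (_ : Fintype κ) (C' : MonomialResolution k n κ),
      C'.ideal = ⨅ i ∈ s, (C i).ideal ∧ C'.maxShift ≤ ∑ i ∈ s, (C i).maxShift := by
  classical
  induction s using Finset.induction_on with
  | empty => exact ⟨Unit, inferInstance, unit k n, by simp [ideal_unit], by simp [maxShift_unit]⟩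
  | insert i s hi ih =>
    obtain ⟨κ, _, C', h1, h2⟩ := ih
    refine ⟨_, inferInstance, inter (C i) C', ?_, ?_⟩
    · rw [ideal_inter, h1, Finset.iInf_insert]
    · rw [Finset.sum_insert hi]
      exact (maxShift_inter_le _ _).trans (by gcongr)

end MonomialResolution

/-! ### From scalar strands to complexes over the polynomial ring -/

namespace MonomialResolution

variable {k : Type*} [Field k] {n : ℕ} {ι : Type} [Fintype ι] (C : MonomialResolution k n ι)

section Total

/-- The matrix of the differential of the resolution. -/
noncomputable def polyD : Matrix ι ι (MvPolynomial (Fin n) k) :=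
  Matrix.of fun l j => monomial (C.deg j - C.deg l) (C.D l j)

/-- The row of the augmentation of the resolution. -/
noncomputable def polyAug (j : ι) : MvPolynomial (Fin n) k := monomial (C.deg j) (C.ε j)

open Classical in
/-- The scalars in the component of multidegree `b` of an element of the resolution. -/
noncomputable def component (b : Fin n →₀ ℕ) (v : ι → MvPolynomial (Fin n) k) (j : ι) : k :=
  if C.deg j ≤ b then coeff (b - C.deg j) (v j) else 0

open Classical in
/-- The element of multidegree `b` with the given scalars. -/
noncomputable def homogenize (b : Fin n →₀ ℕ) (u : ι → k) (j : ι) : MvPolynomial (Fin n) k :=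
  if C.deg j ≤ b then monomial (b - C.deg j) (u j) else 0

theorem component_add_deg (v : ι → MvPolynomial (Fin n) k) (m : Fin n →₀ ℕ) (j : ι) :
    C.component (m + C.deg j) v j = coeff m (v j) := by
  rw [component, if_pos le_add_self, add_tsub_cancel_right]

theorem ext_component {v w : ι → MvPolynomial (Fin n) k}
    (h : ∀ b, C.component b v = C.component b w) : v = w := by
  ext j m
  rw [← C.component_add_deg, h, C.component_add_deg]

theorem component_ne_zero {b : Fin n →₀ ℕ} {v : ι → MvPolynomial (Fin n) k} {j : ι}
    (h : C.component b v j ≠ 0) : C.deg j ≤ b := by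
  by_contra h'
  exact h (if_neg h')

theorem component_zero (b : Fin n →₀ ℕ) : C.component b 0 = 0 := by
  ext j
  simp [component]

theorem component_sum {κ : Type*} (s : Finset κ) (f : κ → ι → MvPolynomial (Fin n) k)
    (b : Fin n →₀ ℕ) : C.component b (∑ i ∈ s, f i) = ∑ i ∈ s, C.component b (f i) := by
  ext j
  rw [Finset.sum_apply]
  by_cases h : C.deg j ≤ b <;> simp [component, h, coeff_sum]

theorem component_homogenize_self {b : Fin n →₀ ℕ} {u : ι → k}
    (hu : ∀ j, u j ≠ 0 → C.deg j ≤ b) : C.component b (C.homogenize b u) = u := by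
  ext j
  by_cases h : C.deg j ≤ b
  · simp [component, homogenize, h]
  · have : u j = 0 := by
      by_contra h'
      exact h (hu j h')
    simp [component, h, this]

theorem component_homogenize_of_ne {b b' : Fin n →₀ ℕ} (h : b ≠ b') (u : ι → k) :
    C.component b (C.homogenize b' u) = 0 := by
  classical
  ext j
  by_cases h1 : C.deg j ≤ b
  · by_cases h2 : C.deg j ≤ b'
    · rw [component, homogenize, if_pos h1, if_pos h2, coeff_monomial, if_neg, Pi.zero_apply]
      exact fun e => h ((tsub_left_inj h1 h2).1 e.symm)
    · simp [component, homogenize, h2]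
  · simp [component, h1]

theorem component_polyD_mulVec (b : Fin n →₀ ℕ) (v : ι → MvPolynomial (Fin n) k) :
    C.component b (C.polyD *ᵥ v) = C.D *ᵥ C.component b v := by
  classical
  ext l
  by_cases hl : C.deg l ≤ b
  · rw [component, if_pos hl, mulVec, mulVec, dotProduct, dotProduct, coeff_sum]
    refine Finset.sum_congr rfl fun j _ => ?_
    by_cases hD : C.D l j = 0
    · simp [polyD, hD]
    · have hlj := C.deg_le hD
      rw [polyD, of_apply, coeff_monomial_mul', component]
      by_cases hj : C.deg j ≤ b
      · rw [if_pos hj, if_pos (tsub_le_tsub_right hj _), tsub_tsub_tsub_cancel_right hlj]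
      · rw [if_neg hj, if_neg, mul_zero]
        rwa [tsub_le_iff_right, tsub_add_cancel_of_le hl]
  · rw [component, if_neg hl, eq_comm]
    refine Finset.sum_eq_zero fun j _ => ?_
    by_cases hD : C.D l j = 0
    · exact mul_eq_zero_of_left hD _
    · rw [component, if_neg fun hj => hl ((C.deg_le hD).trans hj), mul_zero]

theorem coeff_polyAug_dotProduct (b : Fin n →₀ ℕ) (v : ι → MvPolynomial (Fin n) k) :
    coeff b (C.polyAug ⬝ᵥ v) = C.ε ⬝ᵥ C.component b v := by
  classical
  rw [dotProduct, dotProduct, coeff_sum]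
  refine Finset.sum_congr rfl fun j _ => ?_
  rw [polyAug, coeff_monomial_mul', component]
  split_ifs <;> simp

theorem polyAug_dotProduct_polyD (v : ι → MvPolynomial (Fin n) k) :
    C.polyAug ⬝ᵥ (C.polyD *ᵥ v) = 0 := by
  ext b
  rw [coeff_polyAug_dotProduct, component_polyD_mulVec, C.ε_dotProduct_D, coeff_zero]

theorem polyD_mulVec_polyD (v : ι → MvPolynomial (Fin n) k) :
    C.polyD *ᵥ (C.polyD *ᵥ v) = 0 :=
  C.ext_component fun b => by
    rw [component_polyD_mulVec, component_polyD_mulVec, C.D_mulVec_D, component_zero]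

theorem exists_polyD_mulVec_eq {v : ι → MvPolynomial (Fin n) k} (hD : C.polyD *ᵥ v = 0)
    (hε : C.polyAug ⬝ᵥ v = 0) : ∃ w, C.polyD *ᵥ w = v := by
  classical
  choose w hw hDw using fun b => C.exact b (C.component b v) (fun j => C.component_ne_zero)
    (by rw [← component_polyD_mulVec, hD, component_zero])
    (by rw [← coeff_polyAug_dotProduct, hε, coeff_zero])
  -- The finitely many multidegrees in which `v` can have a nonzero component; preimages found
  -- strand by strand are summed over them.
  let B : Finset (Fin n →₀ ℕ) :=
    Finset.univ.biUnion fun j => (v j).support.image (· + C.deg j)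
  have hB : ∀ b, b ∉ B → C.component b v = 0 := fun b hb => by
    ext j
    by_contra h
    have hj := C.component_ne_zero h
    refine hb (Finset.mem_biUnion.2 ⟨j, Finset.mem_univ _, Finset.mem_image.2
      ⟨b - C.deg j, ?_, tsub_add_cancel_of_le hj⟩⟩)
    rw [component, if_pos hj] at h
    exact mem_support_iff.2 h
  refine ⟨∑ b ∈ B, C.homogenize b (w b), C.ext_component fun b => ?_⟩
  rw [component_polyD_mulVec, component_sum]
  by_cases hb : b ∈ B
  · rw [Finset.sum_eq_single_of_mem b hb fun b' _ hb' =>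
      C.component_homogenize_of_ne (Ne.symm hb') _, C.component_homogenize_self (hw b), hDw]
  · rw [Finset.sum_eq_zero fun b' hb' =>
      C.component_homogenize_of_ne (fun (e : b = b') => hb (e ▸ hb')) _, mulVec_zero, hB b hb]

end Total

/-! ### Splitting by homological degree -/

section Graded

/-- The number of basis vectors of homological degree `i`. -/
noncomputable def rank (i : ℕ) : ℕ := Fintype.card {j // C.hdeg j = i}

/-- An enumeration of the basis vectors of homological degree `i`. -/
noncomputable def index (i : ℕ) (a : Fin (C.rank i)) : ι :=
  ((Fintype.equivFin {j // C.hdeg j = i}).symm a : {j // C.hdeg j = i})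

theorem hdeg_index (i : ℕ) (a : Fin (C.rank i)) : C.hdeg (C.index i a) = i :=
  ((Fintype.equivFin {j // C.hdeg j = i}).symm a).2

theorem index_injective (i : ℕ) : Function.Injective (C.index i) :=
  Subtype.val_injective.comp (Equiv.injective _)

theorem exists_index_eq {i : ℕ} {j : ι} (hj : C.hdeg j = i) : ∃ a, C.index i a = j :=
  ⟨Fintype.equivFin {l // C.hdeg l = i} ⟨j, hj⟩, by simp [index]⟩

/-- The inclusion of the part of homological degree `i`. -/
noncomputable def incl (i : ℕ) : (Fin (C.rank i) → MvPolynomial (Fin n) k) →ₗ[MvPolynomial (Fin n) k]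
    (ι → MvPolynomial (Fin n) k) :=
  Function.ExtendByZero.linearMap _ (C.index i)

/-- The projection to the part of homological degree `i`. -/
noncomputable def proj (i : ℕ) : (ι → MvPolynomial (Fin n) k) →ₗ[MvPolynomial (Fin n) k]
    (Fin (C.rank i) → MvPolynomial (Fin n) k) :=
  LinearMap.funLeft _ _ (C.index i)

theorem incl_index (i : ℕ) (v : Fin (C.rank i) → MvPolynomial (Fin n) k) (a : Fin (C.rank i)) :
    C.incl i v (C.index i a) = v a :=
  (C.index_injective i).extend_apply _ _ _

theorem incl_of_ne {i : ℕ} (v : Fin (C.rank i) → MvPolynomial (Fin n) k) {j : ι}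
    (hj : C.hdeg j ≠ i) : C.incl i v j = 0 :=
  Function.extend_apply' _ _ _ fun ⟨a, ha⟩ => hj (by rw [← ha, hdeg_index])

theorem proj_incl (i : ℕ) (v : Fin (C.rank i) → MvPolynomial (Fin n) k) :
    C.proj i (C.incl i v) = v :=
  funext fun a => C.incl_index i v a

theorem incl_proj_apply (v : ι → MvPolynomial (Fin n) k) {i : ℕ} {j : ι} (hj : C.hdeg j = i) :
    C.incl i (C.proj i v) j = v j := by
  obtain ⟨a, rfl⟩ := C.exists_index_eq hj
  exact C.incl_index _ _ _

theorem incl_proj {i : ℕ} {v : ι → MvPolynomial (Fin n) k} (hv : ∀ j, C.hdeg j ≠ i → v j = 0) :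
    C.incl i (C.proj i v) = v := by
  ext1 j
  by_cases hj : C.hdeg j = i
  · exact C.incl_proj_apply v hj
  · rw [C.incl_of_ne _ hj, hv j hj]

theorem incl_single [DecidableEq ι] (i : ℕ) (a : Fin (C.rank i)) :
    C.incl i (Pi.single a 1) = Pi.single (C.index i a) 1 := by
  ext1 j
  by_cases hj : C.hdeg j = i
  · obtain ⟨c, rfl⟩ := C.exists_index_eq hj
    rw [incl_index]
    by_cases hac : c = a
    · subst hac; simp
    · rw [Pi.single_eq_of_ne hac, Pi.single_eq_of_ne ((C.index_injective _).ne hac)]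
  · rw [C.incl_of_ne _ hj, Pi.single_eq_of_ne]
    rintro rfl
    exact hj (C.hdeg_index i a)

theorem polyD_ne_zero {l j : ι} (h : C.polyD l j ≠ 0) : C.D l j ≠ 0 := fun h' =>
  h (by simp [polyD, h'])

theorem polyD_mulVec_eq_zero {i : ℕ} {v : ι → MvPolynomial (Fin n) k}
    (hv : ∀ j, C.hdeg j = i + 1 → v j = 0) {l : ι} (hl : C.hdeg l = i) :
    (C.polyD *ᵥ v) l = 0 := by
  refine Finset.sum_eq_zero fun j _ => ?_
  by_cases h : C.polyD l j = 0
  · exact mul_eq_zero_of_left h _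
  · rw [hv j (by rw [C.hdeg_eq (C.polyD_ne_zero h), hl]), mul_zero]

theorem incl_proj_polyD (i : ℕ) (v : Fin (C.rank (i + 1)) → MvPolynomial (Fin n) k) :
    C.incl i (C.proj i (C.polyD *ᵥ C.incl (i + 1) v)) = C.polyD *ᵥ C.incl (i + 1) v :=
  C.incl_proj fun j hj => C.polyD_mulVec_eq_zero (fun l hl => C.incl_of_ne _ (by omega)) rfl

theorem proj_polyD_incl_proj (i : ℕ) (v : ι → MvPolynomial (Fin n) k) :
    C.proj i (C.polyD *ᵥ C.incl (i + 1) (C.proj (i + 1) v)) = C.proj i (C.polyD *ᵥ v) := by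
  rw [← sub_eq_zero, ← map_sub, ← mulVec_sub]
  ext1 a
  refine C.polyD_mulVec_eq_zero (i := i) (fun j hj => ?_) (C.hdeg_index i a)
  rw [Pi.sub_apply, sub_eq_zero, C.incl_proj_apply v hj]

/-- The differential of the graded resolution. -/
noncomputable def gradedD (i : ℕ) :
    (Fin (C.rank (i + 1)) → MvPolynomial (Fin n) k) →ₗ[MvPolynomial (Fin n) k]
      (Fin (C.rank i) → MvPolynomial (Fin n) k) :=
  C.proj i ∘ₗ mulVecLin C.polyD ∘ₗ C.incl (i + 1)

theorem gradedD_apply (i : ℕ) (v : Fin (C.rank (i + 1)) → MvPolynomial (Fin n) k) :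
    C.gradedD i v = C.proj i (C.polyD *ᵥ C.incl (i + 1) v) := rfl

theorem gradedD_single (i : ℕ) (j : Fin (C.rank (i + 1))) (l : Fin (C.rank i)) :
    C.gradedD i (Pi.single j 1) l = C.polyD (C.index i l) (C.index (i + 1) j) := by
  classical
  rw [gradedD_apply, incl_single, mulVec_single_one]
  rfl

/-- The augmentation of the graded resolution. -/
noncomputable def gradedAug :
    (Fin (C.rank 0) → MvPolynomial (Fin n) k) →ₗ[MvPolynomial (Fin n) k] MvPolynomial (Fin n) k where
  toFun v := C.polyAug ⬝ᵥ C.incl 0 v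
  map_add' v w := by rw [map_add, dotProduct_add]
  map_smul' c v := by rw [map_smul, dotProduct_smul, RingHom.id_apply]

theorem gradedAug_apply (v : Fin (C.rank 0) → MvPolynomial (Fin n) k) :
    C.gradedAug v = C.polyAug ⬝ᵥ C.incl 0 v := rfl

theorem gradedAug_single (j : Fin (C.rank 0)) :
    C.gradedAug (Pi.single j 1) = C.polyAug (C.index 0 j) := by
  classical
  rw [gradedAug_apply, incl_single, dotProduct_single, mul_one]

theorem range_gradedAug : LinearMap.range C.gradedAug = C.ideal := by
  refine le_antisymm ?_ (Ideal.span_le.2 ?_)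
  · rintro _ ⟨v, rfl⟩
    rw [gradedAug_apply, dotProduct]
    refine Ideal.sum_mem _ fun j _ => Ideal.mul_mem_right _ _ ((C.mem_ideal).2 fun a ha => ?_)
    have hε : C.ε j ≠ 0 := fun h => by simp [polyAug, h] at ha
    exact ⟨j, hε, (Finset.mem_singleton.1 (support_monomial_subset ha)).ge⟩
  · rintro _ ⟨_, ⟨j, hj, rfl⟩, rfl⟩
    obtain ⟨a, rfl⟩ := C.exists_index_eq (C.hdeg_eq_zero hj)
    refine ⟨(MvPolynomial.C (C.ε (C.index 0 a))⁻¹ : MvPolynomial (Fin n) k) •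
      (Pi.single a 1 : Fin (C.rank 0) → MvPolynomial (Fin n) k), ?_⟩
    rw [map_smul, gradedAug_single, polyAug, smul_eq_mul, C_mul_monomial, inv_mul_cancel₀ hj]

/-- A preimage in the total complex may be projected to homological degree `i + 1`, because no other
part maps to degree `i`. -/
theorem exists_gradedD_eq {i : ℕ} {v : Fin (C.rank i) → MvPolynomial (Fin n) k}
    (hD : C.polyD *ᵥ C.incl i v = 0) (hε : C.polyAug ⬝ᵥ C.incl i v = 0) :
    ∃ w, C.gradedD i w = v := by
  obtain ⟨w, hw⟩ := C.exists_polyD_mulVec_eq hD hε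
  exact ⟨C.proj (i + 1) w, by rw [gradedD_apply, proj_polyD_incl_proj, hw, proj_incl]⟩

theorem range_gradedD_zero : LinearMap.range (C.gradedD 0) = LinearMap.ker C.gradedAug := by
  refine le_antisymm ?_ fun v hv => C.exists_gradedD_eq ?_ hv
  · rintro _ ⟨v, rfl⟩
    rw [LinearMap.mem_ker, gradedAug_apply, gradedD_apply, incl_proj_polyD,
      polyAug_dotProduct_polyD]
  · ext1 l
    refine Finset.sum_eq_zero fun j _ => ?_
    by_cases h : C.polyD l j = 0
    · exact mul_eq_zero_of_left h _
    · rw [C.incl_of_ne _ (by rw [C.hdeg_eq (C.polyD_ne_zero h)]; omega), mul_zero]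

theorem range_gradedD_succ (i : ℕ) :
    LinearMap.range (C.gradedD (i + 1)) = LinearMap.ker (C.gradedD i) := by
  refine le_antisymm ?_ fun v hv => C.exists_gradedD_eq ?_ ?_
  · rintro _ ⟨v, rfl⟩
    rw [LinearMap.mem_ker, gradedD_apply, gradedD_apply, incl_proj_polyD, polyD_mulVec_polyD,
      map_zero]
  · rw [← incl_proj_polyD, ← gradedD_apply, LinearMap.mem_ker.1 hv, map_zero]
  · refine Finset.sum_eq_zero fun j _ => ?_
    by_cases h : C.ε j = 0
    · rw [polyAug, h, monomial_zero, zero_mul]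
    · rw [C.incl_of_ne _ (by rw [C.hdeg_eq_zero h]; omega), mul_zero]

/-- The graded free resolution given by a monomial resolution. -/
noncomputable def toGraded : GradedFreeResolution C.ideal where
  length := Finset.univ.sup C.hdeg
  rank := C.rank
  rank_eq_zero i hi := Fintype.card_eq_zero_iff.2
    ⟨fun j => hi.not_ge (j.2 ▸ Finset.le_sup (Finset.mem_univ _))⟩
  shift i a := (C.deg (C.index i a)).degree
  aug := C.gradedAug
  d := C.gradedD
  range_aug := C.range_gradedAug
  exact_zero := C.range_gradedD_zero
  exact_succ := C.range_gradedD_succ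
  aug_homogeneous j := by
    rw [gradedAug_single]
    exact isHomogeneousOfIntDegree_monomial _ _
  d_homogeneous i j l := by
    rw [gradedD_single, polyD, of_apply]
    by_cases h : C.D (C.index i l) (C.index (i + 1) j) = 0
    · intro m hm
      simp [h] at hm
    · convert isHomogeneousOfIntDegree_monomial _ _ using 1
      rw [sub_eq_iff_eq_add, ← Nat.cast_add, ← map_add, tsub_add_cancel_of_le (C.deg_le h)]

theorem IsMinimal.toGraded {C : MonomialResolution k n ι} (hC : C.IsMinimal) :
    C.toGraded.IsMinimal := by
  classical
  intro i j l
  refine (congrArg constantCoeff (C.gradedD_single i j l)).trans ?_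
  rw [polyD, of_apply, constantCoeff_monomial]
  by_cases h : C.D (C.index i l) (C.index (i + 1) j) = 0
  · rw [h, ite_self]
  · rw [if_neg]
    intro h0
    -- Truncated subtraction being zero gives only one inequality; `deg_le` supplies the other.
    exact hC _ _ h ((C.deg_le h).antisymm (tsub_eq_zero_iff_le.1 h0))

theorem maxShift_toGraded : C.toGraded.maxShift = C.maxShift := by
  apply le_antisymm
  · refine Finset.sup_le fun i _ => Finset.sup_le fun a _ => ?_
    have h (a : Fin (C.rank i)) :
        (((C.deg (C.index i a)).degree - (i : ℤ) : ℤ) : WithBot ℤ) ≤ C.maxShift := by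
      simpa only [hdeg_index] using C.le_maxShift (C.index i a)
    exact h a
  · refine Finset.sup_le fun j _ => ?_
    obtain ⟨a, ha⟩ := C.exists_index_eq (rfl : C.hdeg j = _)
    have h1 := Finset.le_sup (f := fun a : Fin (C.toGraded.rank (C.hdeg j)) =>
      ((C.toGraded.shift (C.hdeg j) a - (C.hdeg j : ℤ) : ℤ) : WithBot ℤ)) (Finset.mem_univ a)
    have h2 : C.hdeg j ∈ Finset.range (C.toGraded.length + 1) :=
      Finset.mem_range_succ_iff.2 (Finset.le_sup (Finset.mem_univ j))
    refine le_trans (le_of_eq_of_le ?_ h1) (Finset.le_sup (f := fun i => Finset.univ.sup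
      fun a : Fin (C.toGraded.rank i) =>
        ((C.toGraded.shift i a - (i : ℤ) : ℤ) : WithBot ℤ)) h2)
    change _ = (((C.deg (C.index (C.hdeg j) a)).degree - (C.hdeg j : ℤ) : ℤ) : WithBot ℤ)
    rw [ha]

end Graded

end MonomialResolution

/-! ### Regularity of monomial ideals and the main theorem -/

theorem IsMonomialIdeal.exists_minimal {k : Type*} [Field k] {n : ℕ}
    {I : Ideal (MvPolynomial (Fin n) k)} (hI : IsMonomialIdeal I) :
    ∃ (ι : Type) (_ : Fintype ι) (C : MonomialResolution k n ι),
      C.ideal = I ∧ HasMinimalResolution I ∧ C.maxShift = castelnuovoMumfordReg I := by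
  obtain ⟨ι, _, C, rfl, hC⟩ := MonomialResolution.exists_isMinimal hI
  exact ⟨ι, _, C, rfl, ⟨C.toGraded, hC.toGraded⟩,
    by rw [hC.toGraded.castelnuovoMumfordReg_eq, C.maxShift_toGraded]⟩

/-- The regularity of an ideal is bounded by the shifts in any monomial resolution. -/
theorem MonomialResolution.castelnuovoMumfordReg_le {k : Type*} [Field k] {n : ℕ} {ι : Type}
    [Fintype ι] (C : MonomialResolution k n ι) :
    HasMinimalResolution C.ideal ∧ castelnuovoMumfordReg C.ideal ≤ C.maxShift := by
  obtain ⟨R, hR⟩ : HasMinimalResolution C.ideal := by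
    obtain ⟨_, _, _, -, h, -⟩ := IsMonomialIdeal.exists_minimal (I := C.ideal) ⟨_, rfl⟩
    exact h
  refine ⟨⟨R, hR⟩, ?_⟩
  rw [hR.castelnuovoMumfordReg_eq, ← C.maxShift_toGraded]
  exact hR.maxShift_le _

/-- If `I_1, …, I_d` are monomial complete intersections in `k[x_1, …, x_n]`, then
`reg (I_1 ∩ ⋯ ∩ I_d) ≤ reg I_1 + ⋯ + reg I_d`. The first two parts say that all the regularities
in this inequality are those of actual minimal graded free resolutions. -/
theorem theorem3p3 {k : Type*} [Field k] (n d : ℕ)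
    (I : Fin d → Ideal (MvPolynomial (Fin n) k))
    (hI : ∀ j, IsMonomialCompleteIntersection (I j)) :
    (∀ j, HasMinimalResolution (I j)) ∧
    HasMinimalResolution (⨅ j, I j) ∧
    castelnuovoMumfordReg (⨅ j, I j) ≤ ∑ j, castelnuovoMumfordReg (I j) := by
  choose ι _ C hC hres hreg using fun j => (hI j).1.exists_minimal
  refine ⟨hres, ?_⟩
  obtain ⟨κ, _, C', h1, h2⟩ := MonomialResolution.exists_ideal_eq_iInf Finset.univ ι C
  have h3 : C'.ideal = ⨅ j, I j := by simp [h1, hC]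
  rw [← h3]
  refine ⟨C'.castelnuovoMumfordReg_le.1, C'.castelnuovoMumfordReg_le.2.trans (h2.trans ?_)⟩
  exact (Finset.sum_congr rfl fun j _ => hreg j).le
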